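/- **Setting.** Let $\mathcal A$ be a finite set of actions, $\mathcal M(\mathcal A)$ the set of probability distributions on $\mathcal A$, and $n,m\ge 1$ integers. A task $T$ assigns to every action $a$ a distribution $\rho_T(\cdot\mid a)$ of rewards in $[0,1]$; put $R_T(a)=\mathbb E_{r\sim\rho_T(\cdot|a)}[r]$ and $R_T(Q)=\mathbb E_{a\sim Q}[R_T(a)]$ for $Q\in\mathcal M(\mathcal A)$. Tasks $T_1,T_2,\dots$ are drawn i.i.d. from an environment. The data set $D_i=\{(a_{ij},r_{ij})\}_{j=1}^m$ of task $i$ is generated by $a_{ij}\sim b_{ij}(\cdot)=b_{ij}(\cdot\mid D_1,\dots,D_{i-1},D_i^{:j-1})$ and $r_{ij}\sim\rho_{T_i}(\cdot\mid a_{ij})$, where the behaviour policy $b_{ij}$ may depend on all previously observed data and $D_i^{:k}$ denotes the first $k$ pairs of $D_i$. Let $b_{\min}=\min_{i\le n,\,j\le m,\,a\in\mathcal A}b_{ij}(a)$, which is a function of the observed data. A deterministic (measurable) base algorithm $A$ maps a data set and a prior $P\in\mathcal M(\mathcal A)$ to a posterior in $\mathcal M(\mathcal A)$. Hyperpriors and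 hyperposteriors are probability measures on $\mathcal M(\mathcal A)$. Define $$\mathcal R(\mathcal Q)=\mathbb E_{P\sim\mathcal Q}\,\mathbb E_{(T_{n+1},D_{n+1})}\Big[\tfrac1m\sum_{j=1}^m R_{T_{n+1}}\big(A(D_{n+1}^{:j-1},P)\big)\Big],$$ $$\widehat R_i(a)=\frac1m\sum_{j=1}^m\frac{r_{ij}\,\mathbb I\{a_{ij}=a\}}{b_{ij}(a_{ij})},\qquad \widehat{\mathcal R}(\mathcal Q)=\mathbb E_{P\sim\mathcal Q}\Big[\frac1n\sum_{i=1}^n\frac1m\sum_{j=1}^m\mathbb E_{a\sim A(D_i^{:j-1},P)}\big[\widehat R_i(a)\big]\Big],$$ where the expectation over $(T_{n+1},D_{n+1})$ is with respect to its marginal law, and, with $Y_i(P)=\frac1m\sum_{j=1}^m R_{T_i}(A(D_i^{:j-1},P))$, $$c_n=\sup_{P\in\mathcal M(\mathcal A)}\Big\{\frac1n\sum_{i=1}^n\mathbb E\big[Y_i(P)\,\big|\,D_1,\dots,D_{i-1}\big]-\frac1n\sum_{i=1}^n\mathbb E\big[Y_i(P)\big]\Big\},$$ the conditional expectations being taken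 with respect to the conditional law of $(T_i,D_i)$ given $D_1,\dots,D_{i-1}$ that is determined by the environment and the behaviour policies. **Theorem.** Assume that for every prior $P\in\mathcal M(\mathcal A)$, every $1\le j\le m$ and all task indices $i\ge 1$, $k\ge 0$, $$\mathbb E\big[R_{T_{i+k}}(A(D_{i+k}^{:j},P))\big]\ \ge\ \mathbb E\big[R_{T_i}(A(D_i^{:j},P))\big].$$ Then for every hyperprior $\mathcal P$, every fixed $\lambda_1>0$ and $\lambda_2\ge 0$, and every $\delta\in(0,1]$, with probability at least $1-\delta$ over $(T_1,D_1),\dots,(T_n,D_n)$ the following holds: if $\lambda_2\le m\,b_{\min}$, then simultaneously for all hyperposteriors $\mathcal Q$, $$\begin{aligned}\mathcal R(\mathcal Q)\ \ge\ \widehat{\mathcal R}(\mathcal Q)&-\Big(\frac1{\lambda_1}+\frac1{n\lambda_2}\Big)D_{\mathrm{KL}}(\mathcal Q\|\mathcal P)-\frac1{nm\lambda_2}\,\mathbb E_{P\sim\mathcal Q}\Big[\sum_{i=1}^n\sum_{j=1}^m D_{\mathrm{KL}}\big(A(D_i^{:j-1},P)\,\|\,P\big)\Big]\\&-c_n-\frac{\lambda_1}{8n}-\frac{\lambda_2(e-2)}{b_{\min}m}-\frac1{\lambda_1}\ln\frac2\delta-\frac1{n\lambda_2}\ln\frac{2m}\delta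 .\end{aligned}$$ (For $\lambda_2=0$ the right-hand side is read as $-\infty$, and likewise when a relative entropy term is infinite.) In particular, if $\lambda_2\le m\,b_{\min}$ almost surely, the inequality holds with probability at least $1-\delta$ simultaneously for all $\mathcal Q$. -/

import Mathlib

open MeasureTheory ProbabilityTheory InformationTheory
open scoped NNReal ENNReal

namespace LifelongBandit

noncomputable section

/-- The set of all probability measures on `X`, with the σ-algebra that makes every evaluation
`μ ↦ μ s` (`s` measurable) measurable. For a finite action set `A`, `Distr A` is the set
`𝓜(A)` of distributions over actions. -/
abbrev Distr (X : Type*) [MeasurableSpace X] : Type _ := {μ : Measure X // IsProbabilityMeasure μ}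

/-- A bandit task with action set `A`: for every action, a distribution of rewards in `[0, 1]`. -/
abbrev BanditTask (A : Type*) : Type _ := A → Distr unitInterval

/-- A data set of `k` action-reward pairs. -/
abbrev Data (A : Type*) (k : ℕ) : Type _ := Fin k → A × unitInterval

/-- Behaviour policies. Tasks and rounds are numbered from `0`: `b i j` is the distribution of the
action in round `j` of task `i`, given the data sets of the `i` previous tasks (`m` pairs each)
and the `j` previous action-reward pairs of the current task. -/
abbrev Policies (A : Type*) [MeasurableSpace A] (m : ℕ) : Type _ :=
  ∀ i j : ℕ, Kernel ((Fin i → Data A m) × Data A j) A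

/-- A deterministic base learning algorithm: it maps a data set (of any size `k`) and a prior over
actions to a posterior over actions. -/
abbrev BaseAlg (A : Type*) [MeasurableSpace A] : Type _ :=
  ∀ k : ℕ, Data A k × Distr A → Distr A

variable {A : Type*} [Fintype A] [MeasurableSpace A] [DiscreteMeasurableSpace A] {m : ℕ}

/-! ### The law of the tasks and data sets -/

/-- The reward distribution `ρ_T(· | a)` as a kernel in the task `T` and the action `a`. -/
def rewardKernel : Kernel (BanditTask A × A) unitInterval where
  toFun p := (p.1 p.2).1
  measurable' := by
    refine measurable_from_prod_countable_left fun a => ?_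
    exact measurable_subtype_coe.comp (measurable_pi_apply a)

/-- The law of the action-reward pair of round `j` of task `i`, given the previous data sets,
the current task and the previous pairs of the current task:
`a ∼ b i j (· | history)`, then `r ∼ ρ_T(· | a)`. -/
def stepKernel (b : Policies A m) (i j : ℕ) :
    Kernel (((Fin i → Data A m) × BanditTask A) × Data A j) (A × unitInterval) :=
  (b i j).comap (fun x => (x.1.1, x.2)) (by fun_prop) ⊗ₖ
    rewardKernel.comap (fun x => (x.1.1.2, x.2)) (by fun_prop)

/-- The law of the first `j` action-reward pairs of task `i`, given the previous data sets and the
current task. -/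
def dataKernel (b : Policies A m) (i : ℕ) :
    (j : ℕ) → Kernel ((Fin i → Data A m) × BanditTask A) (Data A j)
  | 0 => Kernel.const _ (Measure.dirac Fin.elim0)
  | j + 1 => (dataKernel b i j ⊗ₖ stepKernel b i j).map
      (fun p => Fin.snoc (α := fun _ => A × unitInterval) p.1 p.2)

/-- The conditional law of `(T_i, D_i)` given `D_0, …, D_{i-1}`: the task is drawn from the
environment independently of the past, and `D_i` is then generated by the behaviour policies. -/
def taskDataKernel (env : Distr (BanditTask A)) (b : Policies A m) (i : ℕ) :
    Kernel (Fin i → Data A m) (BanditTask A × Data A m) :=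
  Kernel.const _ env.1 ⊗ₖ dataKernel b i m

/-- The joint law of `(T_0, D_0), …, (T_{N-1}, D_{N-1})`. -/
def jointLaw (env : Distr (BanditTask A)) (b : Policies A m) :
    (N : ℕ) → Measure (Fin N → BanditTask A × Data A m)
  | 0 => Measure.dirac Fin.elim0
  | N + 1 => (jointLaw env b N ⊗ₘ
      (taskDataKernel env b N).comap (fun z k => (z k).2) (by fun_prop)).map
        (fun p => Fin.snoc (α := fun _ => BanditTask A × Data A m) p.1 p.2)

/-- The marginal law of `(T_i, D_i)`. -/
def marginalLaw (env : Distr (BanditTask A)) (b : Policies A m) (i : ℕ) :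
    Measure (BanditTask A × Data A m) :=
  (jointLaw env b (i + 1)).map (fun z => z (Fin.last i))

/-! ### Rewards -/

/-- The expected reward `R_T(Q)` of a distribution `Q` over actions in task `T`. -/
def expReward (T : BanditTask A) (Q : Distr A) : ℝ :=
  ∫ a, (∫ r : unitInterval, (r : ℝ) ∂(T a).1) ∂Q.1

/-- `(1/m) ∑_j R_T(A(D^{:j}, P))`, the sum over `j = 0, …, m - 1`, for `z = (T, D)`. -/
def avgReward (alg : BaseAlg A) (P : Distr A) (z : BanditTask A × Data A m) : ℝ :=
  1 / m * ∑ j : Fin m, expReward z.1 (alg j (Fin.take j j.isLt.le z.2, P))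

/-- The marginal transfer reward of a hyperposterior `𝒬` on the task that comes after `n` tasks
(which has index `n`, as tasks are numbered from `0`). -/
def transferReward (env : Distr (BanditTask A)) (b : Policies A m) (alg : BaseAlg A) (n : ℕ)
    (𝒬 : Distr (Distr A)) : ℝ :=
  ∫ P, (∫ z, avgReward alg P z ∂marginalLaw env b n) ∂𝒬.1

/-- The monotonicity condition: for every prior and every number `1 ≤ j ≤ m` of samples, the
marginal expected reward for a later task is at least that for an earlier task. -/
def MonotoneReward (env : Distr (BanditTask A)) (b : Policies A m) (alg : BaseAlg A) : Prop :=
  ∀ (P : Distr A) (j : ℕ) (hj : j ≤ m), 1 ≤ j → ∀ i k : ℕ,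
    ∫ z, expReward z.1 (alg j (Fin.take j hj z.2, P)) ∂marginalLaw env b i ≤
      ∫ z, expReward z.1 (alg j (Fin.take j hj z.2, P)) ∂marginalLaw env b (i + k)

/-! ### Quantities that depend on the observed tasks and data sets `ω` -/

variable {n : ℕ}

/-- The data sets `D_0, …, D_{i-1}` of the tasks before task `i`. -/
def pastData (ω : Fin n → BanditTask A × Data A m) (i : Fin n) : Fin i → Data A m :=
  fun k => (ω (Fin.castLE i.isLt.le k)).2

/-- The first `j` pairs `D_i^{:j}` of the data set of task `i`. -/
def firstPairs (ω : Fin n → BanditTask A × Data A m) (i : Fin n) (j : Fin m) : Data A j :=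
  Fin.take j j.isLt.le (ω i).2

/-- The probability `b_{ij}(a)` of action `a` under the behaviour policy, conditioned on all
previously observed data. -/
def actionProb (b : Policies A m) (ω : Fin n → BanditTask A × Data A m)
    (i : Fin n) (j : Fin m) (a : A) : ℝ≥0∞ :=
  b i j (pastData ω i, firstPairs ω i j) {a}

/-- `b_min`, the minimum of `b_{ij}(a)` over all tasks `i`, rounds `j` and actions `a`. -/
def bMin (b : Policies A m) (ω : Fin n → BanditTask A × Data A m) : ℝ≥0∞ :=
  ⨅ (i : Fin n) (j : Fin m) (a : A), actionProb b ω i j a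

/-- The importance-weighted estimate of the expected reward of action `a` in task `i`. -/
def iwReward (b : Policies A m) (ω : Fin n → BanditTask A × Data A m) (i : Fin n) (a : A) : ℝ :=
  1 / m * ∑ j : Fin m, 1 / (actionProb b ω i j ((ω i).2 j).1).toReal * (((ω i).2 j).2 : ℝ) *
    ({a} : Set A).indicator 1 ((ω i).2 j).1

/-- The empirical multi-task reward of a hyperposterior. -/
def empiricalReward (b : Policies A m) (alg : BaseAlg A) (ω : Fin n → BanditTask A × Data A m)
    (𝒬 : Distr (Distr A)) : ℝ :=
  ∫ P, (1 / n * ∑ i : Fin n, 1 / m * ∑ j : Fin m,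
    ∫ a, iwReward b ω i a ∂(alg j (firstPairs ω i j, P)).1) ∂𝒬.1

/-- `c_n`: the supremum over priors of the averaged difference between the conditional expectation
given the previous data sets and the expectation of the average reward in task `i`. -/
def cTerm (env : Distr (BanditTask A)) (b : Policies A m) (alg : BaseAlg A)
    (ω : Fin n → BanditTask A × Data A m) : ℝ :=
  ⨆ P : Distr A,
    (1 / n * ∑ i : Fin n, ∫ z, avgReward alg P z ∂taskDataKernel env b i (pastData ω i)) -
      1 / n * ∑ i : Fin n, ∫ z, avgReward alg P z ∂marginalLaw env b i

/-- The expected sum, over tasks and rounds, of the relative entropies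
`D_KL(A(D_i^{:j}, P) ‖ P)`, for `P ∼ 𝒬`. -/
def expectedKL (alg : BaseAlg A) (ω : Fin n → BanditTask A × Data A m)
    (𝒬 : Distr (Distr A)) : ℝ≥0∞ :=
  ∫⁻ P, ∑ i : Fin n, ∑ j : Fin m, klDiv (alg j (firstPairs ω i j, P)).1 P.1 ∂𝒬.1

end

end LifelongBandit

open LifelongBandit

set_option linter.unusedSectionVars false

/-! The gap between empirical and transfer reward splits into four parts: (a) importance-weighted
estimates minus the true rewards of the posteriors; (b) those rewards minus their conditional
expectations given the past data sets; (c) conditional minus marginal expectations, at most `c_n` by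
definition; (d) marginal expectations minus the expected reward on the next task, nonpositive by
monotonicity.

Parts (a) and (b) are PAC-Bayes bounds. For a fixed prior `P`, exponentials of compensated
deviations have conditional mean at most one, so their product over tasks has mean at most one
(`lintegral_prod_jointLaw_le_one`). The hyperprior is fixed before the data, so averaging over it
keeps this bound (`lintegral_mixture_le_one`). Markov's inequality then gives one event for each
part, of probability at least `1 - δ/2`, on which the mixture is at most `2/δ`. On these events the
Donsker–Varadhan inequality yields the bounds for all hyperposteriors at once.

For (b) the moment bound is Hoeffding's lemma. For (a) it is a Bernstein bound for each round
(`lintegral_exp_roundDeviation_le_one`), multiplied over rounds and averaged over actions drawn from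
`P`. Change of measure is used at two levels (`integral_sum_le_klDiv_add_log`): from `P` to each of
the `m` posteriors of a task, always with the same function of the action, and from hyperprior to
hyperposterior. As `b_min` is random, a round is switched off when its own probability is too small
for `λ₂`. This depends only on the history, so the moment bounds hold unconditionally, and no round
is switched off when `λ₂ ≤ m b_min`. -/

namespace LifelongBandit

/-! ### Exponential moments, change of measure, Markov's inequality -/

section General

variable {α : Type*} [MeasurableSpace α]

/-- A bounded measurable real function is integrable with respect to a finite measure. -/
theorem integrable_of_abs_le {μ : Measure α} [IsFiniteMeasure μ] {f : α → ℝ} (hf : Measurable f)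
    {C : ℝ} (hC : ∀ x, |f x| ≤ C) : Integrable f μ :=
  Integrable.of_bound hf.aestronglyMeasurable C (ae_of_all _ hC)

/-- The quadratic upper bound of the exponential function on `[-1, 1]`. -/
theorem exp_le_one_add_add_mul_sq {x : ℝ} (hx : |x| ≤ 1) :
    Real.exp x ≤ 1 + x + (Real.exp 1 - 2) * x ^ 2 := by
  have hsum (y : ℝ) : HasSum (fun k : ℕ => y ^ (k + 2) / (k + 2).factorial)
      (Real.exp y - (1 + y)) := by
    have h := (hasSum_nat_add_iff' (f := fun k : ℕ => y ^ k / (k.factorial : ℝ)) 2).2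
      (Real.exp_eq_exp_ℝ ▸ NormedSpace.expSeries_div_hasSum_exp y)
    simpa [Finset.sum_range_succ] using h
  -- Comparing the series termwise uses `x ^ (k + 2) ≤ x ^ 2`; the remaining coefficients sum to `e
  -- - 2`.
  have h1 : HasSum (fun k : ℕ => x ^ 2 * (1 ^ (k + 2) / ((k + 2).factorial : ℝ)))
      (x ^ 2 * (Real.exp 1 - (1 + 1))) := (hsum 1).mul_left _
  have key := hasSum_le (fun k => ?_) (hsum x) h1
  · linarith
  · rw [pow_add, mul_comm (x ^ k), mul_div_assoc]
    have hk : x ^ k ≤ 1 := (le_abs_self _).trans (by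
      rw [abs_pow]; exact pow_le_one₀ (abs_nonneg x) hx)
    simp only [one_pow]
    gcongr

theorem exp_one_sub_two_nonneg : 0 ≤ Real.exp 1 - 2 := by
  have := Real.add_one_le_exp (1 : ℝ)
  linarith

/-- The Donsker–Varadhan inequality for bounded functions. -/
theorem ofReal_integral_sub_log_le_klDiv (μ ν : Measure α) [IsProbabilityMeasure μ]
    [IsProbabilityMeasure ν] {f : α → ℝ} (hf : Measurable f) {C : ℝ} (hC : ∀ x, |f x| ≤ C) :
    ENNReal.ofReal (∫ x, f x ∂μ - Real.log (∫ x, Real.exp (f x) ∂ν)) ≤ klDiv μ ν := by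
  by_cases h : klDiv μ ν = ∞
  · simp [h]
  obtain ⟨hac, hint⟩ := klDiv_ne_top_iff.1 h
  have hfμ : Integrable f μ := integrable_of_abs_le hf hC
  have hfν : Integrable (fun x => Real.exp (f x)) ν :=
    integrable_of_abs_le (C := Real.exp C) hf.exp fun x => by
      rw [abs_of_pos (Real.exp_pos _)]
      exact Real.exp_le_exp.2 ((le_abs_self _).trans (hC x))
  have := isProbabilityMeasure_tilted hfν
  have h1 := integral_llr_tilted_right hac hfμ hfν hint
  have h2 := toReal_klDiv_of_measure_eq (hac.trans (absolutelyContinuous_tilted hfν))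
    (by simp)
  have h3 := toReal_klDiv_of_measure_eq hac (by simp)
  -- Nonnegativity of the divergence from `μ` to the tilted measure is the whole inequality: by `h1`
  -- that divergence equals `klDiv μ ν - ∫ f ∂μ + log ∫ exp f ∂ν`.
  have h4 : 0 ≤ (klDiv μ (ν.tilted f)).toReal := ENNReal.toReal_nonneg
  rw [← ENNReal.ofReal_toReal h]
  exact ENNReal.ofReal_le_ofReal (by linarith)

/-- The change of measure inequality, with a bound on the exponential moment. -/
theorem integral_le_klDiv_add_log (μ ν : Measure α) [IsProbabilityMeasure μ]
    [IsProbabilityMeasure ν] {f : α → ℝ} (hf : Measurable f) {C : ℝ} (hC : ∀ x, |f x| ≤ C)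
    {c : ℝ} (hc : 0 < c) (hexp : ∫⁻ x, ENNReal.ofReal (Real.exp (f x)) ∂ν ≤ ENNReal.ofReal c)
    (hkl : klDiv μ ν ≠ ∞) :
    ∫ x, f x ∂μ ≤ (klDiv μ ν).toReal + Real.log c := by
  have h1 := (ENNReal.ofReal_le_iff_le_toReal hkl).1 (ofReal_integral_sub_log_le_klDiv μ ν hf hC)
  have hfν : Integrable (fun x => Real.exp (f x)) ν :=
    integrable_of_abs_le (C := Real.exp C) hf.exp fun x => by
      rw [abs_of_pos (Real.exp_pos _)]
      exact Real.exp_le_exp.2 ((le_abs_self _).trans (hC x))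
  rw [← ofReal_integral_eq_lintegral_ofReal hfν (ae_of_all _ fun x => (Real.exp_pos _).le),
    ENNReal.ofReal_le_ofReal_iff hc.le] at hexp
  have h2 := Real.log_le_log (integral_exp_pos hfν) hexp
  linarith

/-- The integral of a bounded function below an extended nonnegative function. -/
theorem integral_le_toReal_lintegral {μ : Measure α} [IsFiniteMeasure μ] {f : α → ℝ}
    (hf : Measurable f) {C : ℝ} (hC : ∀ x, |f x| ≤ C) {g : α → ℝ≥0∞}
    (hfg : ∀ x, ENNReal.ofReal (f x) ≤ g x) (hg : ∫⁻ x, g x ∂μ ≠ ∞) :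
    ∫ x, f x ∂μ ≤ (∫⁻ x, g x ∂μ).toReal := by
  rw [integral_eq_lintegral_pos_part_sub_lintegral_neg_part (integrable_of_abs_le hf hC)]
  -- Monotonicity of the lower integral requires no measurability of `g`, which will be a sum of
  -- relative entropies.
  have := ENNReal.toReal_mono hg (lintegral_mono hfg)
  have h2 : 0 ≤ (∫⁻ x, ENNReal.ofReal (-f x) ∂μ).toReal := ENNReal.toReal_nonneg
  linarith

/-- Hoeffding's lemma for a function with values in `[0, 1]`. -/
theorem lintegral_exp_centered_le_one (μ : Measure α) [IsProbabilityMeasure μ] {f : α → ℝ}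
    (hf : Measurable f) (h01 : ∀ x, f x ∈ Set.Icc (0 : ℝ) 1) (t : ℝ) :
    ∫⁻ x, ENNReal.ofReal (Real.exp (t * (f x - ∫ y, f y ∂μ) - t ^ 2 / 8)) ∂μ ≤ 1 := by
  have h := hasSubgaussianMGF_of_mem_Icc (μ := μ) hf.aemeasurable (ae_of_all _ h01)
  have h1 := h.mgf_le t
  have h2 := h.integrable_exp_mul t
  have h3 : ∫ x, Real.exp (t * (f x - ∫ y, f y ∂μ) - t ^ 2 / 8) ∂μ ≤ 1 := by
    simp_rw [Real.exp_sub, integral_div]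
    rw [div_le_one (Real.exp_pos _)]
    refine h1.trans (Real.exp_le_exp.2 (le_of_eq ?_))
    norm_num
    ring
  rw [← ofReal_integral_eq_lintegral_ofReal _ (ae_of_all _ fun x => (Real.exp_pos _).le)]
  · simpa using ENNReal.ofReal_le_ofReal h3
  · simp_rw [Real.exp_sub]
    exact h2.div_const _

/-- An exponential moment bound of Bernstein type. -/
theorem lintegral_exp_sub_le_one (μ : Measure α) [IsProbabilityMeasure μ] {f : α → ℝ}
    (hf : Measurable f) {t R v : ℝ} (hb : ∀ x, |t * (f x - R)| ≤ 1)
    (hfi : Integrable f μ) (hfi2 : Integrable (fun x => f x ^ 2) μ)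
    (hmean : ∫ x, f x ∂μ = R) (hsq : ∫ x, f x ^ 2 ∂μ ≤ v) :
    ∫⁻ x, ENNReal.ofReal
      (Real.exp (t * (f x - R) - (Real.exp 1 - 2) * t ^ 2 * v)) ∂μ ≤ 1 := by
  have hint : Integrable (fun x => 1 + t * (f x - R)
      + (Real.exp 1 - 2) * t ^ 2 * (f x ^ 2 - 2 * R * f x + R ^ 2)) μ := by fun_prop
  have hexp : Integrable (fun x => Real.exp (t * (f x - R) - (Real.exp 1 - 2) * t ^ 2 * v)) μ := by
    refine integrable_of_abs_le (C := Real.exp (1 - (Real.exp 1 - 2) * t ^ 2 * v))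
      (by fun_prop) fun x => ?_
    rw [abs_of_pos (Real.exp_pos _)]
    exact Real.exp_le_exp.2 (by linarith [(abs_le.1 (hb x)).2])
  rw [← ofReal_integral_eq_lintegral_ofReal hexp (ae_of_all _ fun x => (Real.exp_pos _).le)]
  have h3 : ∫ x, Real.exp (t * (f x - R)) ∂μ ≤ Real.exp ((Real.exp 1 - 2) * t ^ 2 * v) := by
    calc ∫ x, Real.exp (t * (f x - R)) ∂μ
        ≤ ∫ x, (1 + t * (f x - R)
            + (Real.exp 1 - 2) * t ^ 2 * (f x ^ 2 - 2 * R * f x + R ^ 2)) ∂μ := by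
          refine integral_mono_of_nonneg (ae_of_all _ fun x => (Real.exp_pos _).le) hint
            (ae_of_all _ fun x => ?_)
          have := exp_le_one_add_add_mul_sq (hb x)
          refine this.trans (le_of_eq ?_)
          ring
      -- The linear term vanishes because `R` is the mean; the next step discards `-R ^ 2`, so only
      -- the second moment matters.
      _ = 1 + (Real.exp 1 - 2) * t ^ 2 * (∫ x, f x ^ 2 ∂μ - R ^ 2) := by
          rw [integral_add (by fun_prop) (by fun_prop), integral_add (by fun_prop) (by fun_prop),
            integral_const_mul, integral_const_mul, integral_sub hfi (by fun_prop),
            integral_add (by fun_prop) (by fun_prop), integral_sub (by fun_prop) (by fun_prop),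
            integral_const_mul, hmean]
          simp only [integral_const, probReal_univ, smul_eq_mul, one_mul]
          ring
      _ ≤ 1 + (Real.exp 1 - 2) * t ^ 2 * v := by
          have := mul_nonneg exp_one_sub_two_nonneg (sq_nonneg t)
          have h2 : ∫ x, f x ^ 2 ∂μ - R ^ 2 ≤ v := by linarith [sq_nonneg R]
          linarith [mul_le_mul_of_nonneg_left h2 this]
      _ ≤ _ := by
          rw [add_comm]
          exact Real.add_one_le_exp _
  simp_rw [Real.exp_sub, integral_div]
  simpa using ENNReal.ofReal_le_ofReal ((div_le_one (Real.exp_pos _)).2 h3)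

/-- Markov's inequality for a function with integral at most one. -/
theorem measure_lt_le_of_lintegral_le_one {μ : Measure α} {f : α → ℝ≥0∞} (hf : Measurable f)
    (h : ∫⁻ x, f x ∂μ ≤ 1) {δ : ℝ} (hδ : 0 < δ) :
    μ {x | f x ≤ ENNReal.ofReal (2 / δ)}ᶜ ≤ ENNReal.ofReal (δ / 2) := by
  have hpos : 0 < 2 / δ := by positivity
  have h1 := meas_ge_le_lintegral_div (μ := μ) hf.aemeasurable
    (ENNReal.ofReal_pos.2 hpos).ne' ENNReal.ofReal_ne_top
  calc μ {x | f x ≤ ENNReal.ofReal (2 / δ)}ᶜ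
      ≤ μ {x | ENNReal.ofReal (2 / δ) ≤ f x} :=
        measure_mono fun x hx => (not_le.1 (show ¬ f x ≤ _ from hx)).le
    _ ≤ _ := h1
    _ ≤ 1 / ENNReal.ofReal (2 / δ) := by gcongr
    _ = ENNReal.ofReal (δ / 2) := by
        rw [one_div, ← ENNReal.ofReal_inv_of_pos hpos, inv_div]

end General

variable {A : Type*} [Fintype A] [MeasurableSpace A] [DiscreteMeasurableSpace A] {m : ℕ}

/-! ### Laws of tasks and data sets, and products of conditional moments -/

section Laws

instance (X : Type*) [MeasurableSpace X] (μ : Distr X) : IsProbabilityMeasure μ.1 := μ.2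

instance : IsMarkovKernel (rewardKernel (A := A)) := ⟨fun p => (p.1 p.2).2⟩

variable (env : Distr (BanditTask A)) (b : Policies A m) [∀ i j, IsMarkovKernel (b i j)]

instance (i j : ℕ) : IsMarkovKernel (stepKernel b i j) := by
  unfold stepKernel
  infer_instance

theorem measurable_snoc {X : Type*} [MeasurableSpace X] (k : ℕ) :
    Measurable (fun p : (Fin k → X) × X => (Fin.snoc (α := fun _ => X) p.1 p.2 : Fin (k + 1) → X)) := by
  refine measurable_pi_lambda _ fun i => ?_
  refine Fin.lastCases ?_ (fun i => ?_) i
  · simpa using measurable_snd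
  · simp only [Fin.snoc_castSucc]
    exact (measurable_pi_apply i).comp measurable_fst

theorem measurable_take {X : Type*} [MeasurableSpace X] {k l : ℕ} (h : k ≤ l) :
    Measurable (fun v : Fin l → X => (Fin.take k h v : Fin k → X)) :=
  measurable_pi_lambda _ fun _ => measurable_pi_apply _

instance (i j : ℕ) : IsMarkovKernel (dataKernel b i j) := by
  induction j with
  | zero => unfold dataKernel; infer_instance
  | succ j ih => unfold dataKernel; exact Kernel.IsMarkovKernel.map _ (measurable_snoc j)

instance (i : ℕ) : IsMarkovKernel (taskDataKernel env b i) := by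
  unfold taskDataKernel
  infer_instance

instance (N : ℕ) : IsProbabilityMeasure (jointLaw env b N) := by
  induction N with
  | zero => unfold jointLaw; infer_instance
  | succ N ih => unfold jointLaw; exact Measure.isProbabilityMeasure_map (measurable_snoc N).aemeasurable

instance (i : ℕ) : IsProbabilityMeasure (marginalLaw env b i) :=
  Measure.isProbabilityMeasure_map (measurable_pi_apply _).aemeasurable

theorem measurable_pastData {n : ℕ} (i : Fin n) :
    Measurable (fun ω : Fin n → BanditTask A × Data A m => pastData ω i) :=
  measurable_pi_lambda _ fun _ => (measurable_pi_apply _).snd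

theorem pastData_snoc_castSucc {n : ℕ} (ω : Fin n → BanditTask A × Data A m)
    (z : BanditTask A × Data A m) (i : Fin n) :
    pastData (Fin.snoc (α := fun _ => BanditTask A × Data A m) ω z) i.castSucc
      = pastData ω i := by
  funext k
  exact congrArg Prod.snd
    (Fin.snoc_castSucc (α := fun _ => BanditTask A × Data A m) z ω (Fin.castLE i.isLt.le k))

theorem pastData_snoc_last {n : ℕ} (ω : Fin n → BanditTask A × Data A m)
    (z : BanditTask A × Data A m) :
    pastData (Fin.snoc (α := fun _ => BanditTask A × Data A m) ω z) (Fin.last n)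
      = fun k => (ω k).2 := by
  funext k
  exact congrArg Prod.snd
    (Fin.snoc_castSucc (α := fun _ => BanditTask A × Data A m) z ω k)

/-- A product of functions of the successive tasks whose conditional expectations given the past
data sets are at most one has expectation at most one. -/
theorem lintegral_prod_jointLaw_le_one
    {h : ∀ i : ℕ, (Fin i → Data A m) → BanditTask A × Data A m → ℝ≥0∞}
    (hmeas : ∀ i, Measurable (fun p : (Fin i → Data A m) × (BanditTask A × Data A m) => h i p.1 p.2))
    (hle : ∀ i past, ∫⁻ z, h i past z ∂taskDataKernel env b i past ≤ 1) (N : ℕ) :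
    ∫⁻ ω, ∏ i : Fin N, h i (pastData ω i) (ω i) ∂jointLaw env b N ≤ 1 := by
  have hterm (N : ℕ) : Measurable (fun ω : Fin N → BanditTask A × Data A m =>
      ∏ i : Fin N, h i (pastData ω i) (ω i)) :=
    Finset.measurable_prod _ fun i _ =>
      (hmeas i).comp ((measurable_pastData i).prodMk (measurable_pi_apply i))
  induction N with
  | zero => simp
  | succ N ih =>
    rw [jointLaw, lintegral_map (hterm _) (measurable_snoc N)]
    refine (Measure.lintegral_compProd ((hterm _).comp (measurable_snoc N))).trans_le
      ((lintegral_mono fun ω => ?_).trans ih)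
    simp only [Function.comp_apply, Fin.prod_univ_castSucc, pastData_snoc_castSucc, pastData_snoc_last,
      Fin.snoc_castSucc, Fin.snoc_last, Fin.val_castSucc, Fin.val_last]
    -- Given the first `N` tasks their product is constant, and the last factor has conditional mean
    -- at most one.
    exact (lintegral_const_mul _ ((hmeas N).comp
      (measurable_const.prodMk measurable_id))).trans_le (mul_le_of_le_one_right' (hle N _))

/-- The analogue of `lintegral_prod_jointLaw_le_one` for the rounds within one task. -/
theorem lintegral_prod_dataKernel_le_one (i : ℕ) (x : (Fin i → Data A m) × BanditTask A)
    {h : ∀ j : ℕ, Data A j → A × unitInterval → ℝ≥0∞}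
    (hmeas : ∀ j, Measurable (fun p : Data A j × (A × unitInterval) => h j p.1 p.2))
    (hle : ∀ j d, ∫⁻ p, h j d p ∂stepKernel b i j (x, d) ≤ 1) (k : ℕ) :
    ∫⁻ D, ∏ j : Fin k, h j (Fin.take j j.isLt.le D) (D j) ∂dataKernel b i k x ≤ 1 := by
  have hterm (k : ℕ) : Measurable (fun D : Data A k =>
      ∏ j : Fin k, h j (Fin.take j j.isLt.le D) (D j)) :=
    Finset.measurable_prod _ fun j _ =>
      (hmeas j).comp ((measurable_take _).prodMk (measurable_pi_apply j))
  induction k with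
  | zero => simp
  | succ k ih =>
    rw [dataKernel, Kernel.map_apply _ (measurable_snoc k),
      lintegral_map (hterm _) (measurable_snoc k)]
    refine (Kernel.lintegral_compProd _ _ _ ((hterm _).comp (measurable_snoc k))).trans_le
      ((lintegral_mono fun D => ?_).trans ih)
    have htake (p : A × unitInterval) (j : Fin k) :
        (Fin.take j (Nat.le_succ_of_le j.isLt.le)
          (Fin.snoc (α := fun _ => A × unitInterval) D p) : Data A j) = Fin.take j j.isLt.le D := by
      funext l
      exact Fin.snoc_castSucc (α := fun _ => A × unitInterval) p D (Fin.castLE j.isLt.le l)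
    have hlast (p : A × unitInterval) : (Fin.take k (Nat.le_succ k)
        (Fin.snoc (α := fun _ => A × unitInterval) D p) : Data A k) = D := by
      funext l
      exact Fin.snoc_castSucc (α := fun _ => A × unitInterval) p D l
    simp only [Function.comp_apply, Fin.prod_univ_castSucc,
      Fin.snoc_castSucc, Fin.snoc_last, Fin.val_castSucc, Fin.val_last, htake, hlast]
    exact (lintegral_const_mul _ ((hmeas k).comp
      (measurable_const.prodMk measurable_id))).trans_le (mul_le_of_le_one_right' (hle k _))

/-- Each task is drawn independently of the past. This settles the round without data, which the
monotonicity condition leaves out. -/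
theorem map_fst_marginalLaw (i : ℕ) : (marginalLaw env b i).map Prod.fst = env.1 := by
  have h1 : (jointLaw env b (i + 1)).map (fun z => (z (Fin.last i)).1) = env.1 := by
    rw [jointLaw, Measure.map_map (measurable_pi_apply _).fst (measurable_snoc i)]
    ext s hs
    rw [Measure.map_apply ((measurable_pi_apply _).fst.comp (measurable_snoc i)) hs,
      Measure.compProd_apply (((measurable_pi_apply _).fst.comp (measurable_snoc i)) hs)]
    have (z : Fin i → BanditTask A × Data A m) :
        taskDataKernel env b i (fun k => (z k).2) (Prod.fst ⁻¹' s) = env.1 s := by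
      refine (Kernel.fst_apply' _ _ hs).symm.trans ?_
      rw [taskDataKernel, Kernel.fst_compProd, Kernel.const_apply]
    simp [Set.preimage_preimage, this]
  rw [marginalLaw, Measure.map_map measurable_fst (measurable_pi_apply _)]
  exact h1

end Laws

/-! ### Measurability, bounds and monotonicity of rewards -/

section Rewards

/-- The expected reward of an action in a task. -/
noncomputable def actionReward (T : BanditTask A) (a : A) : ℝ :=
  ∫ r : unitInterval, (r : ℝ) ∂(T a).1

theorem integral_mem_Icc {α : Type*} [MeasurableSpace α] (μ : Measure α) [IsProbabilityMeasure μ]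
    {f : α → ℝ} (hf : ∀ x, f x ∈ Set.Icc (0 : ℝ) 1) : ∫ x, f x ∂μ ∈ Set.Icc (0 : ℝ) 1 := by
  refine ⟨integral_nonneg fun x => (hf x).1, ?_⟩
  calc ∫ x, f x ∂μ ≤ ∫ _, (1 : ℝ) ∂μ :=
        integral_mono_of_nonneg (ae_of_all _ fun x => (hf x).1) (integrable_const _)
          (ae_of_all _ fun x => (hf x).2)
    _ = 1 := by simp

theorem actionReward_mem_Icc (T : BanditTask A) (a : A) :
    actionReward T a ∈ Set.Icc (0 : ℝ) 1 :=
  integral_mem_Icc _ fun r => r.2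

theorem measurable_actionReward (a : A) :
    Measurable (fun T : BanditTask A => actionReward T a) := by
  have h (T : BanditTask A) : actionReward T a
      = (∫⁻ r : unitInterval, ENNReal.ofReal (r : ℝ) ∂(T a).1).toReal :=
    integral_eq_lintegral_of_nonneg_ae (ae_of_all _ fun r => r.2.1)
      measurable_subtype_coe.aestronglyMeasurable
  simp_rw [h]
  exact ((Measure.measurable_lintegral measurable_subtype_coe.ennreal_ofReal).comp
    (measurable_subtype_coe.comp (measurable_pi_apply a))).ennreal_toReal

theorem measurable_distr_singleton (a : A) : Measurable (fun Q : Distr A => Q.1 {a}) :=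
  (Measure.measurable_coe (measurableSet_singleton a)).comp measurable_subtype_coe

/-- Finiteness of the action set reduces measurability in `Q` to that of the point masses. -/
theorem integral_distr (Q : Distr A) (f : A → ℝ) :
    ∫ a, f a ∂Q.1 = ∑ a, (Q.1 {a}).toReal * f a := by
  rw [integral_fintype Integrable.of_finite]
  rfl

theorem expReward_mem_Icc (T : BanditTask A) (Q : Distr A) :
    expReward T Q ∈ Set.Icc (0 : ℝ) 1 :=
  integral_mem_Icc _ fun a => actionReward_mem_Icc T a

theorem measurable_expReward :
    Measurable (fun p : BanditTask A × Distr A => expReward p.1 p.2) := by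
  have h (p : BanditTask A × Distr A) : expReward p.1 p.2
      = ∑ a, (p.2.1 {a}).toReal * actionReward p.1 a := integral_distr _ _
  simp_rw [h]
  exact Finset.measurable_sum _ fun a _ =>
    ((measurable_distr_singleton a).comp measurable_snd).ennreal_toReal.mul
      ((measurable_actionReward a).comp measurable_fst)

variable {alg : BaseAlg A}

theorem measurable_expReward_alg (halg : ∀ k, Measurable (alg k)) {j : ℕ} (hj : j ≤ m) :
    Measurable (fun p : Distr A × (BanditTask A × Data A m) =>
      expReward p.2.1 (alg j (Fin.take j hj p.2.2, p.1))) :=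
  measurable_expReward.comp (measurable_snd.fst.prodMk ((halg j).comp
    (((measurable_take hj).comp measurable_snd.snd).prodMk measurable_fst)))

theorem measurable_avgReward (halg : ∀ k, Measurable (alg k)) :
    Measurable (fun p : Distr A × (BanditTask A × Data A m) => avgReward alg p.1 p.2) :=
  (Finset.measurable_sum _ fun j _ => measurable_expReward_alg halg j.isLt.le).const_mul _

theorem avgReward_mem_Icc (alg : BaseAlg A) (P : Distr A) (z : BanditTask A × Data A m) :
    avgReward alg P z ∈ Set.Icc (0 : ℝ) 1 := by
  have h0 : ∀ j : Fin m, expReward z.1 (alg j (Fin.take j j.isLt.le z.2, P)) ∈ Set.Icc (0 : ℝ) 1 :=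
    fun j => expReward_mem_Icc _ _
  refine ⟨mul_nonneg (by positivity) (Finset.sum_nonneg fun j _ => (h0 j).1), ?_⟩
  have h1 := Finset.sum_le_sum fun j (_ : j ∈ Finset.univ) => (h0 j).2
  simp only [Finset.sum_const, Finset.card_univ, Fintype.card_fin, nsmul_eq_mul, mul_one] at h1
  rw [avgReward, one_div_mul_eq_div]
  exact div_le_one_of_le₀ h1 (by positivity)

variable (env : Distr (BanditTask A)) (b : Policies A m) [∀ i j, IsMarkovKernel (b i j)]

theorem measurable_condReward (halg : ∀ k, Measurable (alg k)) (i : ℕ) :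
    Measurable (fun p : Distr A × (Fin i → Data A m) =>
      ∫ z, avgReward alg p.1 z ∂taskDataKernel env b i p.2) := by
  have h : StronglyMeasurable
      (fun q : (Distr A × (Fin i → Data A m)) × (BanditTask A × Data A m) =>
        avgReward alg q.1.1 q.2) :=
    ((measurable_avgReward halg).comp (measurable_fst.fst.prodMk measurable_snd)).stronglyMeasurable
  exact (h.integral_kernel_prod_right'
    (κ := (taskDataKernel env b i).comap Prod.snd measurable_snd)).measurable

theorem measurable_integral_avgReward (halg : ∀ k, Measurable (alg k))
    (μ : Measure (BanditTask A × Data A m)) [SFinite μ] :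
    Measurable (fun P : Distr A => ∫ z, avgReward alg P z ∂μ) :=
  ((measurable_avgReward halg).stronglyMeasurable.integral_prod_right' (ν := μ)).measurable

/-- Under the monotonicity condition, the average expected reward does not decrease with the
number of the task. -/
theorem integral_avgReward_le_of_monotoneReward (halg : ∀ k, Measurable (alg k))
    (hmono : MonotoneReward env b alg) (P : Distr A) {i n : ℕ} (hin : i ≤ n) :
    ∫ z, avgReward alg P z ∂marginalLaw env b i ≤ ∫ z, avgReward alg P z ∂marginalLaw env b n := by
  have hint (l : ℕ) (j : Fin m) : Integrable
      (fun z => expReward z.1 (alg j (Fin.take j j.isLt.le z.2, P))) (marginalLaw env b l) :=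
    Integrable.of_mem_Icc 0 1 ((measurable_expReward_alg halg j.isLt.le).comp
      (measurable_const.prodMk measurable_id)).aemeasurable
      (ae_of_all _ fun z => expReward_mem_Icc _ _)
  simp only [avgReward]
  rw [integral_const_mul, integral_const_mul, integral_finsetSum _ fun j _ => hint i j,
    integral_finsetSum _ fun j _ => hint n j]
  refine mul_le_mul_of_nonneg_left (Finset.sum_le_sum fun j _ => ?_) (by positivity)
  obtain ⟨j, hj⟩ := j
  -- Monotonicity is assumed only for `1 ≤ j`. With no data the posterior is a fixed distribution
  -- and the task has law `env`, so the two sides agree.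
  rcases Nat.eq_zero_or_pos j with rfl | hpos
  · have h (l : ℕ) : ∫ z, expReward z.1 (alg 0 (Fin.take 0 hj.le z.2, P)) ∂marginalLaw env b l
        = ∫ T, expReward T (alg 0 (Fin.elim0, P)) ∂env.1 := by
      rw [← map_fst_marginalLaw env b l]
      refine Eq.trans ?_ (integral_map measurable_fst.aemeasurable
        (measurable_expReward.comp
          (measurable_id.prodMk measurable_const)).aestronglyMeasurable).symm
      exact integral_congr_ae (ae_of_all _ fun z =>
        congrArg (fun d => expReward z.1 (alg 0 (d, P))) (Subsingleton.elim _ _))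
    exact ((h i).trans (h n).symm).le
  · obtain ⟨k, rfl⟩ := Nat.exists_eq_add_of_le hin
    exact hmono P j hj.le hpos i k

end Rewards

/-! ### Exponential moments of importance-weighted rewards -/

section ImportanceWeighting

/-- The importance-weighted reward of the action `a` for an observed pair, where `q` is the
probability of `a` under the behaviour policy. -/
noncomputable def weightedReward (q : ℝ≥0∞) (a : A) (p : A × unitInterval) : ℝ :=
  1 / q.toReal * (p.2 : ℝ) * ({a} : Set A).indicator 1 p.1

/-- The compensated deviation of the importance-weighted reward from its mean in one round, set to
zero if `lam` is too large for the probability `q`. -/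
noncomputable def roundDeviation (m : ℕ) (lam : ℝ≥0) (q : ℝ≥0∞) (R : ℝ) (a : A)
    (p : A × unitInterval) : ℝ :=
  open Classical in
  if (lam : ℝ≥0∞) ≤ m * q then
    lam / m * (weightedReward q a p - R) - (Real.exp 1 - 2) * (lam / m : ℝ) ^ 2 * (1 / q.toReal)
  else 0

theorem measurable_indicator_singleton (a : A) :
    Measurable (fun x : A => ({a} : Set A).indicator (1 : A → ℝ) x) :=
  Measurable.of_discrete

theorem measurable_weightedReward (a : A) :
    Measurable (fun x : ℝ≥0∞ × (A × unitInterval) => weightedReward x.1 a x.2) :=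
  ((measurable_fst.ennreal_toReal.const_div 1).mul
    (measurable_subtype_coe.comp measurable_snd.snd)).mul
    ((measurable_indicator_singleton a).comp measurable_snd.fst)

theorem measurable_roundDeviation (lam : ℝ≥0) (a : A) :
    Measurable (fun x : ℝ≥0∞ × ℝ × (A × unitInterval) =>
      roundDeviation m lam x.1 x.2.1 a x.2.2) := by
  refine Measurable.ite (measurableSet_le measurable_const (measurable_fst.const_mul _)) ?_
    measurable_const
  have := (measurable_weightedReward a).comp
    (measurable_fst.prodMk measurable_snd.snd : Measurable
      (fun x : ℝ≥0∞ × ℝ × (A × unitInterval) => (x.1, x.2.2)))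
  exact ((this.sub measurable_snd.fst).const_mul _).sub
    ((measurable_fst.ennreal_toReal.const_div 1).const_mul _)

variable (b : Policies A m)

/-- Supplies both moments of the weighted reward: the factor `q` cancels one weight `1/q`, giving
mean `R`, and leaves one in the square, giving at most `1/q`. -/
theorem integral_stepKernel_indicator [∀ i j, IsMarkovKernel (b i j)] (i j : ℕ)
    (x : ((Fin i → Data A m) × BanditTask A) × Data A j) (a : A) {g : unitInterval → ℝ}
    (hg : Measurable g) {C : ℝ} (hC : ∀ r, |g r| ≤ C) :
    ∫ p, g p.2 * ({a} : Set A).indicator 1 p.1 ∂stepKernel b i j x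
      = (b i j (x.1.1, x.2) {a}).toReal * ∫ r, g r ∂(x.1.2 a).1 := by
  have hind (y : A) : |({a} : Set A).indicator (1 : A → ℝ) y| ≤ 1 := by
    by_cases h : y ∈ ({a} : Set A) <;> simp [h]
  have hint : Integrable (fun p : A × unitInterval => g p.2 * ({a} : Set A).indicator 1 p.1)
      (stepKernel b i j x) := by
    refine integrable_of_abs_le ((hg.comp measurable_snd).mul
      ((measurable_indicator_singleton a).comp measurable_fst)) (C := C * 1) fun p => ?_
    rw [abs_mul]
    exact mul_le_mul (hC _) (hind _) (abs_nonneg _) ((abs_nonneg _).trans (hC p.2))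
  rw [stepKernel] at hint ⊢
  rw [integral_compProd hint, integral_fintype Integrable.of_finite,
    Finset.sum_eq_single a (fun a' _ h => by simp [h]) (by simp)]
  simp [rewardKernel, measureReal_def]

/-- An active round has `λ/m ≤ q`, so the scaled deviation of a weight bounded by `1/q` stays in
`[-1, 1]`. The Bernstein bound applies with second moment `1/q`, exactly the compensator. -/
theorem lintegral_exp_roundDeviation_le_one [∀ i j, IsMarkovKernel (b i j)] {lam : ℝ≥0} (hlam : 0 < lam) (hm : 1 ≤ m) (i j : ℕ)
    (x : ((Fin i → Data A m) × BanditTask A) × Data A j) (a : A) :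
    ∫⁻ p, ENNReal.ofReal (Real.exp (roundDeviation m lam (b i j (x.1.1, x.2) {a})
      (actionReward x.1.2 a) a p)) ∂stepKernel b i j x ≤ 1 := by
  set q := b i j (x.1.1, x.2) {a} with hq
  by_cases hle : (lam : ℝ≥0∞) ≤ m * q
  swap
  -- A switched-off round contributes the factor `exp 0 = 1`.
  · simp [roundDeviation, hle]
  have hq1 : q ≤ 1 := prob_le_one
  have hqtop : q ≠ ∞ := ne_top_of_le_ne_top ENNReal.one_ne_top hq1
  have hm0 : (0 : ℝ) < m := by exact_mod_cast hm
  have hle' : (lam : ℝ) ≤ m * q.toReal := by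
    have := ENNReal.toReal_mono (ENNReal.mul_ne_top (ENNReal.natCast_ne_top m) hqtop) hle
    simpa using this
  have hlam' : (0 : ℝ) < lam := hlam
  have hq0 : 0 < q.toReal := by
    by_contra h
    have : q.toReal ≤ 0 := not_lt.1 h
    nlinarith
  have hq1' : q.toReal ≤ 1 := by simpa using ENNReal.toReal_mono ENNReal.one_ne_top hq1
  have ht : (lam / m : ℝ) ≤ q.toReal := by rw [div_le_iff₀ hm0]; linarith
  have hcoe (p : A × unitInterval) : 0 ≤ weightedReward q a p ∧ weightedReward q a p ≤ 1 / q.toReal := by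
    have h1 := p.2.2.1
    have h2 := p.2.2.2
    have h3 : 0 < 1 / q.toReal := by positivity
    by_cases h : p.1 ∈ ({a} : Set A)
    · simp only [weightedReward, Set.indicator_of_mem h, Pi.one_apply, mul_one]
      exact ⟨by positivity, mul_le_of_le_one_right h3.le h2⟩
    · simp only [weightedReward, Set.indicator_of_notMem h, mul_zero]
      exact ⟨le_rfl, h3.le⟩
  have hmeas : Measurable (weightedReward q a) :=
    (measurable_weightedReward a).comp (measurable_const.prodMk measurable_id)
  simp only [roundDeviation, hle, if_true]
  have hsq (p : A × unitInterval) : weightedReward q a p ^ 2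
      = (1 / q.toReal * (p.2 : ℝ)) ^ 2 * ({a} : Set A).indicator 1 p.1 := by
    by_cases h : p.1 ∈ ({a} : Set A) <;> simp [weightedReward, h]
  have hbd (r : unitInterval) : |1 / q.toReal * (r : ℝ)| ≤ 1 / q.toReal := by
    rw [abs_of_nonneg (mul_nonneg (by positivity) r.2.1)]
    exact mul_le_of_le_one_right (by positivity) r.2.2
  have hmr : Measurable (fun r : unitInterval => 1 / q.toReal * (r : ℝ)) :=
    measurable_subtype_coe.const_mul _
  refine lintegral_exp_sub_le_one _ hmeas (fun p => ?_) ?_ ?_ ?_ ?_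
  · have hR := actionReward_mem_Icc x.1.2 a
    obtain ⟨h1, h2⟩ := hcoe p
    have ht0 : (0 : ℝ) ≤ lam / m := by positivity
    rw [abs_le]
    constructor
    · nlinarith [mul_le_mul_of_nonneg_left hR.2 ht0, mul_nonneg ht0 h1]
    · have h3 : (lam / m : ℝ) * weightedReward q a p ≤ q.toReal * (1 / q.toReal) :=
        mul_le_mul ht h2 h1 hq0.le
      rw [mul_one_div_cancel hq0.ne'] at h3
      nlinarith [mul_nonneg ht0 hR.1]
  · exact integrable_of_abs_le hmeas fun p => by rw [abs_of_nonneg (hcoe p).1]; exact (hcoe p).2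
  · exact integrable_of_abs_le (hmeas.pow_const 2) (C := (1 / q.toReal) ^ 2) fun p => by
      rw [abs_of_nonneg (sq_nonneg _)]
      exact pow_le_pow_left₀ (hcoe p).1 (hcoe p).2 2
  · have := integral_stepKernel_indicator b i j x a hmr hbd
    refine this.trans ?_
    rw [integral_const_mul, ← hq, ← mul_assoc, mul_one_div_cancel hq0.ne', one_mul]
    rfl
  · simp_rw [hsq]
    rw [integral_stepKernel_indicator b i j x a (g := fun r => (1 / q.toReal * (r : ℝ)) ^ 2)
      (hmr.pow_const 2) (C := (1 / q.toReal) ^ 2)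
      (fun r => by rw [abs_pow]; exact pow_le_pow_left₀ (abs_nonneg _) (hbd r) 2), ← hq]
    simp_rw [mul_pow]
    rw [integral_const_mul]
    have h1 : ∫ r : unitInterval, (r : ℝ) ^ 2 ∂(x.1.2 a).1 ≤ 1 :=
      (integral_mem_Icc _ fun r : unitInterval =>
        ⟨sq_nonneg _, pow_le_one₀ r.2.1 r.2.2⟩).2
    calc q.toReal * ((1 / q.toReal) ^ 2 * ∫ r : unitInterval, (r : ℝ) ^ 2 ∂(x.1.2 a).1)
        = 1 / q.toReal * ∫ r : unitInterval, (r : ℝ) ^ 2 ∂(x.1.2 a).1 := by field_simp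
      _ ≤ 1 / q.toReal := mul_le_of_le_one_right (by positivity) h1

/-- The compensated deviation of the importance-weighted reward of the action `a` in task `i`. -/
noncomputable def taskDeviation (lam : ℝ≥0) (i : ℕ) (past : Fin i → Data A m)
    (z : BanditTask A × Data A m) (a : A) : ℝ :=
  ∑ j : Fin m, roundDeviation m lam (b i j (past, Fin.take j j.isLt.le z.2) {a})
    (actionReward z.1 a) a (z.2 j)

theorem measurable_taskDeviation (lam : ℝ≥0) (i : ℕ) (a : A) :
    Measurable (fun p : (Fin i → Data A m) × (BanditTask A × Data A m) =>
      taskDeviation b lam i p.1 p.2 a) :=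
  Finset.measurable_sum _ fun j _ => (measurable_roundDeviation lam a).comp
    ((((b i j).measurable_coe (measurableSet_singleton a)).comp
      (measurable_fst.prodMk ((measurable_take j.isLt.le).comp measurable_snd.snd))).prodMk
    (((measurable_actionReward a).comp measurable_snd.fst).prodMk
      ((measurable_pi_apply j).comp measurable_snd.snd)))

/-- Conditionally on the task, the exponential is a product over rounds whose factors have
conditional mean at most one given the history. -/
theorem lintegral_exp_taskDeviation_le_one [∀ i j, IsMarkovKernel (b i j)] (env : Distr (BanditTask A)) {lam : ℝ≥0}
    (hlam : 0 < lam) (hm : 1 ≤ m) (i : ℕ) (past : Fin i → Data A m) (a : A) :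
    ∫⁻ z, ENNReal.ofReal (Real.exp (taskDeviation b lam i past z a))
      ∂taskDataKernel env b i past ≤ 1 := by
  refine (Kernel.lintegral_compProd _ _ _ ((measurable_taskDeviation b lam i a).comp
    (measurable_const.prodMk measurable_id)).exp.ennreal_ofReal).trans_le ?_
  refine (lintegral_mono fun T => ?_).trans (b := ∫⁻ _, 1 ∂env.1) (by simp)
  have h := lintegral_prod_dataKernel_le_one b i (past, T)
    (h := fun j d p => ENNReal.ofReal (Real.exp (roundDeviation m lam (b i j (past, d) {a})
      (actionReward T a) a p)))
    (fun j => ((measurable_roundDeviation lam a).comp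
      ((((b i j).measurable_coe (measurableSet_singleton a)).comp
        (measurable_const.prodMk measurable_fst)).prodMk
        (measurable_const.prodMk measurable_snd))).exp.ennreal_ofReal)
    (fun j d => lintegral_exp_roundDeviation_le_one b hlam hm i j ((past, T), d) a) m
  refine le_trans (le_of_eq (lintegral_congr fun D => ?_)) h
  simp only [Function.comp_apply, taskDeviation]
  rw [Real.exp_sum, ENNReal.ofReal_prod_of_nonneg fun j _ => (Real.exp_pos _).le]
  rfl

/-- The exponential moment, for an action drawn from the prior, of the deviation in task `i`. -/
noncomputable def deviationMoment (lam : ℝ≥0) (i : ℕ) (past : Fin i → Data A m)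
    (z : BanditTask A × Data A m) (P : Distr A) : ℝ :=
  ∫ a, Real.exp (taskDeviation b lam i past z a) ∂P.1

theorem measurable_deviationMoment (lam : ℝ≥0) (i : ℕ) :
    Measurable (fun p : Distr A × ((Fin i → Data A m) × (BanditTask A × Data A m)) =>
      deviationMoment b lam i p.2.1 p.2.2 p.1) := by
  simp only [deviationMoment, integral_distr]
  exact Finset.measurable_sum _ fun a _ =>
    ((measurable_distr_singleton a).comp measurable_fst).ennreal_toReal.mul
      ((measurable_taskDeviation b lam i a).comp measurable_snd).exp

/-- The prior does not depend on the data, so the average over actions can be interchanged with the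
expectation. -/
theorem lintegral_deviationMoment_le_one [∀ i j, IsMarkovKernel (b i j)] (env : Distr (BanditTask A)) {lam : ℝ≥0}
    (hlam : 0 < lam) (hm : 1 ≤ m) (i : ℕ) (past : Fin i → Data A m) (P : Distr A) :
    ∫⁻ z, ENNReal.ofReal (deviationMoment b lam i past z P) ∂taskDataKernel env b i past ≤ 1 := by
  have h (z : BanditTask A × Data A m) : ENNReal.ofReal (deviationMoment b lam i past z P)
      = ∑ a, ENNReal.ofReal (Real.exp (taskDeviation b lam i past z a)) * P.1 {a} := by
    rw [deviationMoment, ofReal_integral_eq_lintegral_ofReal Integrable.of_finite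
      (ae_of_all _ fun a => (Real.exp_pos _).le), lintegral_fintype]
  have hmeas (a : A) : Measurable
      (fun z => ENNReal.ofReal (Real.exp (taskDeviation b lam i past z a))) :=
    ((measurable_taskDeviation b lam i a).comp
      (measurable_const.prodMk measurable_id)).exp.ennreal_ofReal
  simp_rw [h]
  rw [lintegral_finsetSum _ fun a _ => (hmeas a).mul_const _]
  calc ∑ a, ∫⁻ z, ENNReal.ofReal (Real.exp (taskDeviation b lam i past z a)) * P.1 {a}
        ∂taskDataKernel env b i past
      ≤ ∑ a, P.1 {a} := Finset.sum_le_sum fun a _ => by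
        rw [lintegral_mul_const _ (hmeas a)]
        exact mul_le_of_le_one_left' (lintegral_exp_taskDeviation_le_one b env hlam hm i past a)
    _ = 1 := by
        simp

end ImportanceWeighting

/-! ### Bounds for the parts of the decomposition -/

section Bound

variable {n : ℕ}

theorem abs_integral_le {α : Type*} [MeasurableSpace α] (μ : Measure α) [IsProbabilityMeasure μ]
    {f : α → ℝ} {C : ℝ} (hC : ∀ x, |f x| ≤ C) : |∫ x, f x ∂μ| ≤ C := by
  have h : ∀ᵐ x ∂μ, ‖f x‖ ≤ C := ae_of_all _ hC
  simpa using norm_integral_le_of_norm_le_const h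

theorem abs_le_one_of_mem_Icc {x : ℝ} (hx : x ∈ Set.Icc (0 : ℝ) 1) : |x| ≤ 1 := by
  rw [abs_of_nonneg hx.1]; exact hx.2

theorem abs_average_le {k : ℕ} {f : Fin k → ℝ} {C : ℝ} (hC0 : 0 ≤ C) (hC : ∀ i, |f i| ≤ C) :
    |1 / (k : ℝ) * ∑ i, f i| ≤ C := by
  rcases Nat.eq_zero_or_pos k with rfl | hk
  · simpa using hC0
  have hk' : (0 : ℝ) < k := by exact_mod_cast hk
  rw [abs_mul, abs_of_nonneg (by positivity : (0 : ℝ) ≤ 1 / k), one_div_mul_eq_div,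
    div_le_iff₀ hk']
  calc |∑ i, f i| ≤ ∑ i, |f i| := Finset.abs_sum_le_sum_abs _ _
    _ ≤ ∑ _i : Fin k, C := Finset.sum_le_sum fun i _ => hC i
    _ = C * k := by simp [mul_comm]

variable (env : Distr (BanditTask A)) (b : Policies A m) {alg : BaseAlg A}

/-- The mixture over priors of a product of functions of the successive tasks. -/
theorem lintegral_mixture_le_one [∀ i j, IsMarkovKernel (b i j)] (P₀ : Distr (Distr A))
    {h : ∀ i : ℕ, Distr A → (Fin i → Data A m) → BanditTask A × Data A m → ℝ≥0∞}
    (hmeas : ∀ i, Measurable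
      (fun p : Distr A × ((Fin i → Data A m) × (BanditTask A × Data A m)) =>
        h i p.1 p.2.1 p.2.2))
    (hle : ∀ i P past, ∫⁻ z, h i P past z ∂taskDataKernel env b i past ≤ 1) (n : ℕ) :
    Measurable (fun ω : Fin n → BanditTask A × Data A m =>
        ∫⁻ P, ∏ i : Fin n, h i P (pastData ω i) (ω i) ∂P₀.1) ∧
      ∫⁻ ω, ∫⁻ P, ∏ i : Fin n, h i P (pastData ω i) (ω i) ∂P₀.1 ∂jointLaw env b n ≤ 1 := by
  have hjoint : Measurable (fun p : (Fin n → BanditTask A × Data A m) × Distr A =>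
      ∏ i : Fin n, h i p.2 (pastData p.1 i) (p.1 i)) :=
    Finset.measurable_prod _ fun i _ => (hmeas i).comp (measurable_snd.prodMk
      (((measurable_pastData i).comp measurable_fst).prodMk
        ((measurable_pi_apply i).comp measurable_fst)))
  refine ⟨hjoint.lintegral_prod_right', ?_⟩
  -- Tonelli is available because the hyperprior is independent of `ω`.
  rw [lintegral_lintegral_swap hjoint.aemeasurable]
  refine (lintegral_mono fun P => ?_).trans (b := ∫⁻ _, 1 ∂P₀.1) (by simp)
  exact lintegral_prod_jointLaw_le_one env b
    (fun i => (hmeas i).comp (measurable_const.prodMk measurable_id)) (fun i => hle i P) n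

/-- The exponential of the compensated deviation of the average reward in task `i` from its
conditional expectation. -/
noncomputable def rewardMoment (alg : BaseAlg A) (t : ℝ) (i : ℕ) (P : Distr A)
    (past : Fin i → Data A m) (z : BanditTask A × Data A m) : ℝ≥0∞ :=
  ENNReal.ofReal (Real.exp (t * (avgReward alg P z
    - ∫ z', avgReward alg P z' ∂taskDataKernel env b i past) - t ^ 2 / 8))

theorem measurable_rewardMoment [∀ i j, IsMarkovKernel (b i j)] (halg : ∀ k, Measurable (alg k))
    (t : ℝ) (i : ℕ) :
    Measurable (fun p : Distr A × ((Fin i → Data A m) × (BanditTask A × Data A m)) =>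
      rewardMoment env b alg t i p.1 p.2.1 p.2.2) :=
  (((((measurable_avgReward halg).comp (measurable_fst.prodMk measurable_snd.snd)).sub
    ((measurable_condReward env b halg i).comp
      (measurable_fst.prodMk measurable_snd.fst))).const_mul t).sub_const
        (t ^ 2 / 8)).exp.ennreal_ofReal

theorem lintegral_rewardMoment_le_one [∀ i j, IsMarkovKernel (b i j)]
    (halg : ∀ k, Measurable (alg k)) (t : ℝ) (i : ℕ) (P : Distr A) (past : Fin i → Data A m) :
    ∫⁻ z, rewardMoment env b alg t i P past z ∂taskDataKernel env b i past ≤ 1 :=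
  lintegral_exp_centered_le_one _
    ((measurable_avgReward halg).comp (measurable_const.prodMk measurable_id))
    (fun z => avgReward_mem_Icc alg P z) t

/-- The average over tasks of the observed average rewards. -/
noncomputable def meanReward (alg : BaseAlg A) (ω : Fin n → BanditTask A × Data A m)
    (P : Distr A) : ℝ :=
  1 / n * ∑ i : Fin n, avgReward alg P (ω i)

/-- The average over tasks of the conditional expectations of the average rewards. -/
noncomputable def meanCondReward (alg : BaseAlg A) (ω : Fin n → BanditTask A × Data A m)
    (P : Distr A) : ℝ :=
  1 / n * ∑ i : Fin n, ∫ z, avgReward alg P z ∂taskDataKernel env b i (pastData ω i)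

theorem measurable_meanReward (halg : ∀ k, Measurable (alg k))
    (ω : Fin n → BanditTask A × Data A m) : Measurable (meanReward alg ω) :=
  (Finset.measurable_sum _ fun _i _ =>
    (measurable_avgReward halg).comp (measurable_id.prodMk measurable_const)).const_mul _

theorem abs_meanReward_le_one (ω : Fin n → BanditTask A × Data A m) (P : Distr A) :
    |meanReward alg ω P| ≤ 1 :=
  abs_average_le zero_le_one fun i => abs_le_one_of_mem_Icc (avgReward_mem_Icc alg P (ω i))

theorem measurable_meanCondReward [∀ i j, IsMarkovKernel (b i j)] (halg : ∀ k, Measurable (alg k))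
    (ω : Fin n → BanditTask A × Data A m) : Measurable (meanCondReward env b alg ω) :=
  Measurable.const_mul (Finset.measurable_sum _ fun (i : Fin n) _ =>
    (measurable_condReward env b halg i).comp
      (measurable_id.prodMk (measurable_const (a := pastData ω i)))) _

theorem abs_meanCondReward_le_one [∀ i j, IsMarkovKernel (b i j)]
    (ω : Fin n → BanditTask A × Data A m) (P : Distr A) :
    |meanCondReward env b alg ω P| ≤ 1 :=
  abs_average_le zero_le_one fun _ =>
    abs_le_one_of_mem_Icc (integral_mem_Icc _ fun z => avgReward_mem_Icc alg P z)

/-- The deviation of the observed average rewards from their conditional expectations. -/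
theorem integral_meanReward_sub_le [∀ i j, IsMarkovKernel (b i j)]
    (halg : ∀ k, Measurable (alg k)) (hn : 1 ≤ n) (P₀ 𝒬 : Distr (Distr A)) {lam : ℝ}
    (hlam : 0 < lam) {c : ℝ} (hc : 0 < c) (ω : Fin n → BanditTask A × Data A m)
    (hω : ∫⁻ P, ∏ i : Fin n, rewardMoment env b alg (lam / n) i P (pastData ω i) (ω i) ∂P₀.1
      ≤ ENNReal.ofReal c)
    (hkl : klDiv 𝒬.1 P₀.1 ≠ ∞) :
    ∫ P, meanReward alg ω P ∂𝒬.1 - ∫ P, meanCondReward env b alg ω P ∂𝒬.1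
      ≤ 1 / lam * (klDiv 𝒬.1 P₀.1).toReal + lam / (8 * n) + 1 / lam * Real.log c := by
  have hn0 : (0 : ℝ) < n := by exact_mod_cast hn
  set f : Distr A → ℝ := fun P =>
    lam * (meanReward alg ω P - meanCondReward env b alg ω P) - lam ^ 2 / (8 * n) with hf
  have hmeas : Measurable f :=
    (((measurable_meanReward halg ω).sub (measurable_meanCondReward env b halg ω)).const_mul
      lam).sub_const _
  have hbd (P : Distr A) : |f P| ≤ lam * 2 + lam ^ 2 / (8 * n) := by
    have h1 := abs_le.1 (abs_meanReward_le_one (alg := alg) ω P)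
    have h2 := abs_le.1 (abs_meanCondReward_le_one env b (alg := alg) ω P)
    have h3 : 0 ≤ lam ^ 2 / (8 * n) := by positivity
    rw [hf, abs_le]
    constructor <;> nlinarith
  -- With `t = lam / n` the `n` compensators `t ^ 2 / 8` add up to `lam ^ 2 / (8 * n)`.
  have hexp : ∫⁻ P, ENNReal.ofReal (Real.exp (f P)) ∂P₀.1 ≤ ENNReal.ofReal c := by
    refine le_trans (le_of_eq (lintegral_congr fun P => ?_)) hω
    simp only [rewardMoment]
    rw [← ENNReal.ofReal_prod_of_nonneg fun i _ => (Real.exp_pos _).le, ← Real.exp_sum]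
    congr 2
    rw [Finset.sum_sub_distrib, ← Finset.mul_sum, Finset.sum_sub_distrib]
    simp only [hf, meanReward, meanCondReward, Finset.sum_const, Finset.card_univ,
      Fintype.card_fin, nsmul_eq_mul]
    field_simp
  have hdv := integral_le_klDiv_add_log 𝒬.1 P₀.1 hmeas hbd hc hexp hkl
  have hi1 := integrable_of_abs_le (μ := 𝒬.1) (measurable_meanReward halg ω)
    (abs_meanReward_le_one ω)
  have hi2 := integrable_of_abs_le (μ := 𝒬.1) (measurable_meanCondReward env b halg ω)
    (abs_meanCondReward_le_one env b ω)
  have hint : ∫ P, f P ∂𝒬.1 = lam * (∫ P, meanReward alg ω P ∂𝒬.1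
      - ∫ P, meanCondReward env b alg ω P ∂𝒬.1) - lam ^ 2 / (8 * n) := by
    refine (integral_sub ((hi1.sub hi2).const_mul lam)
      (integrable_const (lam ^ 2 / (8 * n)))).trans ?_
    exact congrArg₂ (· - ·) ((integral_const_mul _ _).trans (congrArg _ (integral_sub hi1 hi2)))
      (by simp)
  rw [hint] at hdv
  have h : lam * (∫ P, meanReward alg ω P ∂𝒬.1 - ∫ P, meanCondReward env b alg ω P ∂𝒬.1)
      ≤ lam * (1 / lam * (klDiv 𝒬.1 P₀.1).toReal + lam / (8 * n) + 1 / lam * Real.log c) := by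
    have : lam * (1 / lam * (klDiv 𝒬.1 P₀.1).toReal + lam / (8 * n) + 1 / lam * Real.log c)
        = (klDiv 𝒬.1 P₀.1).toReal + lam ^ 2 / (8 * n) + Real.log c := by field_simp
    linarith
  exact le_of_mul_le_mul_left h hlam

/-- The average conditional expected reward exceeds the expected reward on a later task by at most
`c_n`. -/
theorem integral_meanCondReward_sub_cTerm_le [∀ i j, IsMarkovKernel (b i j)]
    (halg : ∀ k, Measurable (alg k)) (hmono : MonotoneReward env b alg) (hn : 1 ≤ n)
    (𝒬 : Distr (Distr A)) (ω : Fin n → BanditTask A × Data A m) :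
    ∫ P, meanCondReward env b alg ω P ∂𝒬.1 - cTerm env b alg ω
      ≤ transferReward env b alg n 𝒬 := by
  have hn0 : (0 : ℝ) < n := by exact_mod_cast hn
  have hmarg (i : ℕ) (P : Distr A) :
      ∫ z, avgReward alg P z ∂marginalLaw env b i ∈ Set.Icc (0 : ℝ) 1 :=
    integral_mem_Icc _ fun z => avgReward_mem_Icc alg P z
  -- The real supremum in `cTerm` dominates its terms only if the family is bounded; unbounded it
  -- would default to zero.
  have hbdd : BddAbove (Set.range fun P : Distr A => meanCondReward env b alg ω P
      - 1 / n * ∑ i : Fin n, ∫ z, avgReward alg P z ∂marginalLaw env b i) := by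
    refine ⟨2, ?_⟩
    rintro _ ⟨P, rfl⟩
    have h1 := abs_le.1 (abs_meanCondReward_le_one env b (alg := alg) ω P)
    have h2 := abs_le.1 (abs_average_le zero_le_one
      fun i : Fin n => abs_le_one_of_mem_Icc (hmarg i P))
    dsimp only
    linarith
  have hpt (P : Distr A) : meanCondReward env b alg ω P
      ≤ ∫ z, avgReward alg P z ∂marginalLaw env b n + cTerm env b alg ω := by
    have h1 : meanCondReward env b alg ω P
        - 1 / n * ∑ i : Fin n, ∫ z, avgReward alg P z ∂marginalLaw env b i ≤ cTerm env b alg ω :=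
      le_ciSup hbdd P
    have h2 : 1 / (n : ℝ) * ∑ i : Fin n, ∫ z, avgReward alg P z ∂marginalLaw env b i
        ≤ ∫ z, avgReward alg P z ∂marginalLaw env b n := by
      rw [one_div_mul_eq_div, div_le_iff₀ hn0]
      calc ∑ i : Fin n, ∫ z, avgReward alg P z ∂marginalLaw env b i
          ≤ ∑ _i : Fin n, ∫ z, avgReward alg P z ∂marginalLaw env b n :=
            Finset.sum_le_sum fun i _ =>
              integral_avgReward_le_of_monotoneReward env b halg hmono P i.isLt.le
        _ = (∫ z, avgReward alg P z ∂marginalLaw env b n) * n := by simp [mul_comm]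
    linarith
  have hint : Integrable (fun P => ∫ z, avgReward alg P z ∂marginalLaw env b n) 𝒬.1 :=
    integrable_of_abs_le (measurable_integral_avgReward halg _)
      fun P => abs_le_one_of_mem_Icc (hmarg n P)
  have h := integral_mono (integrable_of_abs_le (measurable_meanCondReward env b halg ω)
    (abs_meanCondReward_le_one env b ω)) (hint.add (integrable_const (cTerm env b alg ω))) hpt
  have h2 := h.trans_eq (integral_add hint (integrable_const (cTerm env b alg ω)))
  rw [integral_const, probReal_univ, one_smul] at h2
  exact sub_le_iff_le_add.2 h2

/-- The deviation of the importance-weighted rewards, on the event that `lam` is at most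
`m * bMin`. -/
theorem taskDeviation_ge (hm : 1 ≤ m) [∀ i j, IsMarkovKernel (b i j)] {lam : ℝ≥0} (hlam : 0 < lam)
    (ω : Fin n → BanditTask A × Data A m) (hle : (lam : ℝ≥0∞) ≤ m * bMin b ω)
    (i : Fin n) (a : A) :
    lam * (iwReward b ω i a - actionReward (ω i).1 a)
        - (Real.exp 1 - 2) * lam ^ 2 / (m * (bMin b ω).toReal)
      ≤ taskDeviation b lam i (pastData ω i) (ω i) a := by
  have hm0 : (0 : ℝ) < m := by exact_mod_cast hm
  have hq (j : Fin m) : bMin b ω ≤ actionProb b ω i j a :=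
    (iInf_le _ i).trans ((iInf_le _ j).trans (iInf_le _ a))
  have hqtop (j : Fin m) : actionProb b ω i j a ≠ ∞ := measure_ne_top _ _
  have hb0 : bMin b ω ≠ 0 := by
    intro h
    rw [h, mul_zero, nonpos_iff_eq_zero, ENNReal.coe_eq_zero] at hle
    exact hlam.ne' hle
  have hbtop : bMin b ω ≠ ∞ := ne_top_of_le_ne_top (hqtop ⟨0, hm⟩) (hq _)
  have hβ : 0 < (bMin b ω).toReal := ENNReal.toReal_pos hb0 hbtop
  have hround (j : Fin m) :
      lam / m * (weightedReward (actionProb b ω i j a) a ((ω i).2 j) - actionReward (ω i).1 a)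
          - (Real.exp 1 - 2) * (lam / m : ℝ) ^ 2 * (1 / (bMin b ω).toReal)
        ≤ roundDeviation m lam (b i j (pastData ω i, Fin.take j j.isLt.le (ω i).2) {a})
          (actionReward (ω i).1 a) a ((ω i).2 j) := by
    -- Every round is active here, so the compensators with `1/q` may be enlarged to `1 / bMin`.
    have h1 : (lam : ℝ≥0∞) ≤ m * actionProb b ω i j a := hle.trans (by gcongr; exact hq j)
    have h2 : 1 / (actionProb b ω i j a).toReal ≤ 1 / (bMin b ω).toReal :=
      one_div_le_one_div_of_le hβ (ENNReal.toReal_mono (hqtop j) (hq j))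
    change _ ≤ roundDeviation m lam (actionProb b ω i j a) _ _ _
    rw [roundDeviation, if_pos h1]
    have h3 : 0 ≤ (Real.exp 1 - 2) * (lam / m : ℝ) ^ 2 :=
      mul_nonneg exp_one_sub_two_nonneg (sq_nonneg _)
    linarith [mul_le_mul_of_nonneg_left h2 h3]
  have hiw : iwReward b ω i a
      = 1 / m * ∑ j, weightedReward (actionProb b ω i j a) a ((ω i).2 j) := by
    rw [iwReward]
    congr 1
    refine Finset.sum_congr rfl fun j _ => ?_
    -- The estimator divides by the probability of the drawn action, the deviation by that of `a`;
    -- the indicator makes them agree.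
    by_cases h : ((ω i).2 j).1 = a
    · simp [weightedReward, h]
    · simp [weightedReward, h]
  refine le_trans (le_of_eq ?_) (Finset.sum_le_sum fun j _ => hround j)
  rw [Finset.sum_sub_distrib, ← Finset.mul_sum, Finset.sum_sub_distrib, hiw]
  simp only [Finset.sum_const, Finset.card_univ, Fintype.card_fin, nsmul_eq_mul]
  field_simp

theorem measurable_integral_alg (halg : ∀ k, Measurable (alg k)) {k : ℕ} (d : Data A k)
    (f : A → ℝ) : Measurable (fun P : Distr A => ∫ a, f a ∂(alg k (d, P)).1) := by
  simp_rw [integral_distr]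
  exact Finset.measurable_sum _ fun a _ => (((measurable_distr_singleton a).comp
    ((halg k).comp (measurable_const.prodMk measurable_id))).ennreal_toReal).mul_const _

/-- The empirical reward of a prior. -/
noncomputable def meanIwReward (alg : BaseAlg A) (ω : Fin n → BanditTask A × Data A m)
    (P : Distr A) : ℝ :=
  1 / n * ∑ i : Fin n, 1 / m * ∑ j : Fin m,
    ∫ a, iwReward b ω i a ∂(alg j (firstPairs ω i j, P)).1

theorem integrable_meanIwReward (halg : ∀ k, Measurable (alg k))
    (ω : Fin n → BanditTask A × Data A m) (μ : Measure (Distr A)) [IsFiniteMeasure μ] :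
    Integrable (meanIwReward b alg ω) μ := by
  obtain ⟨C, hC⟩ := (Set.finite_range fun p : Fin n × A => |iwReward b ω p.1 p.2|).bddAbove
  have hC' (i : Fin n) (a : A) : |iwReward b ω i a| ≤ max C 0 :=
    (hC ⟨(i, a), rfl⟩).trans (le_max_left _ _)
  refine integrable_of_abs_le (C := max C 0) ?_ fun P => ?_
  · exact (Finset.measurable_sum _ fun i _ => (Finset.measurable_sum _ fun j _ =>
      measurable_integral_alg halg _ _).const_mul _).const_mul _
  · exact abs_average_le (le_max_right _ _) fun i => abs_average_le (le_max_right _ _)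
      fun j => abs_integral_le _ (hC' i)

/-- The change of measure inequality for a prior that is drawn from a hyperprior, followed by
independent draws from the prior for all tasks. -/
theorem integral_sum_le_klDiv_add_log {Q : Fin n → Fin m → Distr A → Distr A}
    (hQ : ∀ i j, Measurable (Q i j)) (P₀ 𝒬 : Distr (Distr A)) (d : Fin n → A → ℝ)
    {c : ℝ} (hc : 0 < c)
    (hexp : ∫⁻ P : Distr A, ∏ i : Fin n, ENNReal.ofReal (∫ a, Real.exp (d i a) ∂P.1) ∂P₀.1
      ≤ ENNReal.ofReal c)
    (hkl : klDiv 𝒬.1 P₀.1 ≠ ∞)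
    (hK : ∫⁻ P, ∑ i : Fin n, ∑ j : Fin m, klDiv (Q i j P).1 P.1 ∂𝒬.1 ≠ ∞) :
    Integrable (fun P => ∑ i : Fin n, ∑ j : Fin m, ∫ a, d i a ∂(Q i j P).1) 𝒬.1 ∧
    ∫ P, (∑ i : Fin n, ∑ j : Fin m, ∫ a, d i a ∂(Q i j P).1) ∂𝒬.1
      ≤ m * ((klDiv 𝒬.1 P₀.1).toReal + Real.log c)
        + (∫⁻ P, ∑ i : Fin n, ∑ j : Fin m, klDiv (Q i j P).1 P.1 ∂𝒬.1).toReal := by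
  obtain ⟨C, hC0, hC⟩ : ∃ C : ℝ, 0 ≤ C ∧ ∀ i a, |d i a| ≤ C := by
    obtain ⟨C, hC⟩ := (Set.finite_range fun p : Fin n × A => |d p.1 p.2|).bddAbove
    exact ⟨max C 0, le_max_right _ _, fun i a => (hC ⟨(i, a), rfl⟩).trans (le_max_left _ _)⟩
  have hmeasInt (f : A → ℝ) : Measurable (fun P : Distr A => ∫ a, f a ∂P.1) := by
    simp_rw [integral_distr]
    exact Finset.measurable_sum _ fun a _ =>
      (measurable_distr_singleton a).ennreal_toReal.mul_const _
  have hM0 (i : Fin n) (P : Distr A) : 0 < ∫ a, Real.exp (d i a) ∂P.1 :=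
    integral_exp_pos Integrable.of_finite
  have hlogM (i : Fin n) (P : Distr A) : |Real.log (∫ a, Real.exp (d i a) ∂P.1)| ≤ C := by
    have h1 := integral_mono (μ := P.1) (integrable_const (Real.exp (-C))) Integrable.of_finite
        (fun a => Real.exp_le_exp.2 (abs_le.1 (hC i a)).1)
    have h2 := integral_mono (μ := P.1) Integrable.of_finite (integrable_const (Real.exp C))
        (fun a => Real.exp_le_exp.2 (abs_le.1 (hC i a)).2)
    rw [integral_const, probReal_univ, one_smul] at h1 h2
    exact abs_le.2 ⟨(Real.le_log_iff_exp_le (hM0 i P)).2 h1,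
      (Real.log_le_iff_le_exp (hM0 i P)).2 h2⟩
  obtain ⟨g, hg⟩ : ∃ g : Distr A → ℝ,
      ∀ P, g P = ∑ i, Real.log (∫ a, Real.exp (d i a) ∂P.1) := ⟨_, fun _ => rfl⟩
  obtain ⟨S, hS⟩ : ∃ S : Distr A → ℝ,
      ∀ P, S P = ∑ i : Fin n, ∑ j : Fin m, ∫ a, d i a ∂(Q i j P).1 := ⟨_, fun _ => rfl⟩
  have hgmeas : Measurable g := by
    rw [funext hg]
    exact Finset.measurable_sum _ fun i _ => (hmeasInt _).log
  have hgbd (P : Distr A) : |g P| ≤ n * C := by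
    rw [hg]
    refine (Finset.abs_sum_le_sum_abs _ _).trans ?_
    simpa using Finset.sum_le_sum fun i (_ : i ∈ Finset.univ) => hlogM i P
  have hgexp : ∫⁻ P, ENNReal.ofReal (Real.exp (g P)) ∂P₀.1 ≤ ENNReal.ofReal c := by
    refine le_trans (le_of_eq (lintegral_congr fun P => ?_)) hexp
    rw [← ENNReal.ofReal_prod_of_nonneg fun i _ => (hM0 i P).le, hg, Real.exp_sum]
    exact congrArg _ (Finset.prod_congr rfl fun i _ => Real.exp_log (hM0 i P))
  have hdv := integral_le_klDiv_add_log 𝒬.1 P₀.1 hgmeas hgbd hc hgexp hkl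
  have hSmeas : Measurable S := by
    rw [funext hS]
    exact Finset.measurable_sum _ fun i _ => Finset.measurable_sum _ fun j _ =>
      (hmeasInt (d i)).comp (hQ i j)
  have hSbd (P : Distr A) : |S P| ≤ n * (m * C) := by
    rw [hS]
    refine (Finset.abs_sum_le_sum_abs _ _).trans ((Finset.sum_le_sum fun i _ =>
      (Finset.abs_sum_le_sum_abs _ _).trans (Finset.sum_le_sum fun j _ =>
        abs_integral_le _ (hC i))).trans ?_)
    simp
  have hUbd (P : Distr A) : |S P - m * g P| ≤ n * (m * C) + m * (n * C) := by
    refine (abs_sub _ _).trans (add_le_add (hSbd P) ?_)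
    rw [abs_mul, Nat.abs_cast]
    exact mul_le_mul_of_nonneg_left (hgbd P) (Nat.cast_nonneg m)
  have hkey (P : Distr A) : ENNReal.ofReal (S P - m * g P)
      ≤ ∑ i : Fin n, ∑ j : Fin m, klDiv (Q i j P).1 P.1 := by
    -- Each log-moment occurs `m` times, since all `m` posteriors of task `i` are compared with `P`
    -- through the same `d i`. Hence no union bound over rounds is needed.
    have h1 : S P - m * g P = ∑ i : Fin n, ∑ j : Fin m,
        (∫ a, d i a ∂(Q i j P).1 - Real.log (∫ a, Real.exp (d i a) ∂P.1)) := by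
      simp only [hS, hg, Finset.sum_sub_distrib, Finset.sum_const, Finset.card_univ,
        Fintype.card_fin, nsmul_eq_mul, Finset.mul_sum]
    have hsub {k : ℕ} (f : Fin k → ℝ) :
        ENNReal.ofReal (∑ i, f i) ≤ ∑ i, ENNReal.ofReal (f i) :=
      Finset.le_sum_of_subadditive _ ENNReal.ofReal_zero.le
        (fun x y => ENNReal.ofReal_add_le) _ _
    rw [h1]
    refine (hsub _).trans (Finset.sum_le_sum fun i _ => (hsub _).trans
      (Finset.sum_le_sum fun j _ => ?_))
    exact ofReal_integral_sub_log_le_klDiv _ P.1 Measurable.of_discrete (hC i)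
  have hU := integral_le_toReal_lintegral (μ := 𝒬.1) (hSmeas.sub (hgmeas.const_mul (m : ℝ))) hUbd
    hkey hK
  have hSint := integrable_of_abs_le (μ := 𝒬.1) hSmeas hSbd
  have hgint := integrable_of_abs_le (μ := 𝒬.1) hgmeas hgbd
  have hU' : ∫ P, S P ∂𝒬.1 - m * ∫ P, g P ∂𝒬.1
      ≤ (∫⁻ P, ∑ i : Fin n, ∑ j : Fin m, klDiv (Q i j P).1 P.1 ∂𝒬.1).toReal := by
    rw [← integral_const_mul, ← integral_sub hSint (hgint.const_mul _)]
    exact hU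
  simp_rw [← hS]
  exact ⟨hSint, by linarith [mul_le_mul_of_nonneg_left hdv (Nat.cast_nonneg (α := ℝ) m)]⟩

/-- The total deviation over all tasks and rounds bounds the deviation of the empirical reward. -/
theorem meanIwReward_sub_le_sum [∀ i j, IsMarkovKernel (b i j)] (hn : 1 ≤ n) (hm : 1 ≤ m)
    {lam : ℝ≥0} (hlam : 0 < lam) (ω : Fin n → BanditTask A × Data A m)
    (hle : (lam : ℝ≥0∞) ≤ m * bMin b ω) (P : Distr A) :
    n * m * lam * (meanIwReward b alg ω P - meanReward alg ω P)
        - n * m * ((Real.exp 1 - 2) * lam ^ 2 / (m * (bMin b ω).toReal))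
      ≤ ∑ i : Fin n, ∑ j : Fin m, ∫ a, taskDeviation b lam i (pastData ω i) (ω i) a
          ∂(alg j (firstPairs ω i j, P)).1 := by
  have hn0 : (0 : ℝ) < n := by exact_mod_cast hn
  have hm0 : (0 : ℝ) < m := by exact_mod_cast hm
  generalize hε : (Real.exp 1 - 2) * lam ^ 2 / (m * (bMin b ω).toReal) = ε
  have h1 (i : Fin n) (j : Fin m) :
      lam * (∫ a, iwReward b ω i a ∂(alg j (firstPairs ω i j, P)).1
          - expReward (ω i).1 (alg j (firstPairs ω i j, P))) - ε
        ≤ ∫ a, taskDeviation b lam i (pastData ω i) (ω i) a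
          ∂(alg j (firstPairs ω i j, P)).1 := by
    have h := integral_mono (μ := (alg j (firstPairs ω i j, P)).1) Integrable.of_finite
      Integrable.of_finite (fun a => taskDeviation_ge b hm hlam ω hle i a)
    rw [integral_sub Integrable.of_finite (integrable_const _), integral_const_mul,
      integral_sub Integrable.of_finite Integrable.of_finite, integral_const, probReal_univ,
      one_smul, hε] at h
    exact h
  refine le_trans (le_of_eq ?_) (Finset.sum_le_sum fun i _ => Finset.sum_le_sum fun j _ => h1 i j)
  simp only [Finset.sum_sub_distrib, ← Finset.mul_sum, Finset.sum_const, Finset.card_univ,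
    Fintype.card_fin, nsmul_eq_mul, meanIwReward, meanReward, avgReward, firstPairs]
  field_simp

/-- The deviation of the importance-weighted rewards from the expected rewards. -/
theorem integral_meanIwReward_sub_le [∀ i j, IsMarkovKernel (b i j)]
    (halg : ∀ k, Measurable (alg k)) (hn : 1 ≤ n) (hm : 1 ≤ m) (P₀ 𝒬 : Distr (Distr A))
    {lam : ℝ≥0} (hlam : 0 < lam) {c : ℝ} (hc : 0 < c) (ω : Fin n → BanditTask A × Data A m)
    (hω : ∫⁻ P, ∏ i : Fin n, ENNReal.ofReal
      (deviationMoment b lam i (pastData ω i) (ω i) P) ∂P₀.1 ≤ ENNReal.ofReal c)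
    (hle : (lam : ℝ≥0∞) ≤ m * bMin b ω)
    (hkl : klDiv 𝒬.1 P₀.1 ≠ ∞) (hK : expectedKL alg ω 𝒬 ≠ ∞) :
    empiricalReward b alg ω 𝒬 - ∫ P, meanReward alg ω P ∂𝒬.1
      ≤ 1 / (n * lam) * (klDiv 𝒬.1 P₀.1).toReal
        + 1 / (n * m * lam) * (expectedKL alg ω 𝒬).toReal
        + lam * (Real.exp 1 - 2) / ((bMin b ω).toReal * m) + 1 / (n * lam) * Real.log c := by
  have hn0 : (0 : ℝ) < n := by exact_mod_cast hn
  have hm0 : (0 : ℝ) < m := by exact_mod_cast hm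
  have hlam0 : (0 : ℝ) < lam := hlam
  obtain ⟨hSint, hS⟩ := integral_sum_le_klDiv_add_log
    (Q := fun i j P => alg j (firstPairs ω i j, P))
    (fun i j => (halg j).comp (measurable_const.prodMk measurable_id)) P₀ 𝒬
    (fun i a => taskDeviation b lam i (pastData ω i) (ω i) a) hc hω hkl hK
  have hI1 := integrable_meanIwReward b halg ω 𝒬.1
  have hI2 := integrable_of_abs_le (μ := 𝒬.1) (measurable_meanReward halg ω)
    (abs_meanReward_le_one ω)
  have hpt := meanIwReward_sub_le_sum b (alg := alg) hn hm hlam ω hle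
  generalize hε : (Real.exp 1 - 2) * lam ^ 2 / (m * (bMin b ω).toReal) = ε at hpt
  have hmain := integral_mono (((hI1.sub hI2).const_mul (n * m * lam : ℝ)).sub
    (integrable_const (n * m * ε))) hSint hpt
  have hleft : ∫ P, (n * m * lam * (meanIwReward b alg ω P - meanReward alg ω P)
      - n * m * ε) ∂𝒬.1 = n * m * lam * (empiricalReward b alg ω 𝒬
        - ∫ P, meanReward alg ω P ∂𝒬.1) - n * m * ε := by
    refine (integral_sub ((hI1.sub hI2).const_mul (n * m * lam : ℝ))
      (integrable_const (n * m * ε))).trans ?_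
    exact congrArg₂ (· - ·) ((integral_const_mul _ _).trans (congrArg _ (integral_sub hI1 hI2)))
      (by simp)
  have hmain' := (hleft.symm.trans_le hmain).trans hS
  have hpos : (0 : ℝ) < n * m * lam := by positivity
  refine le_of_mul_le_mul_left ?_ hpos
  have hexpand : n * m * lam * (1 / (n * lam) * (klDiv 𝒬.1 P₀.1).toReal
        + 1 / (n * m * lam) * (expectedKL alg ω 𝒬).toReal
        + lam * (Real.exp 1 - 2) / ((bMin b ω).toReal * m) + 1 / (n * lam) * Real.log c)
      = m * (klDiv 𝒬.1 P₀.1).toReal + (expectedKL alg ω 𝒬).toReal + n * m * ε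
        + m * Real.log c := by
    rw [← hε]
    field_simp
  rw [hexpand]
  change _ ≤ _ + (expectedKL alg ω 𝒬).toReal at hmain'
  linarith

end Bound

/-- Subtracting a finite extended nonnegative number from a real number. -/
theorem ereal_sub_le_of_sub_toReal_le {x y : ℝ} {e : ℝ≥0∞}
    (h : e ≠ ∞ → x - e.toReal ≤ y) : (x : EReal) - (e : EReal) ≤ y := by
  by_cases he : e = ∞
  · simp [he]
  · rw [← EReal.coe_ennreal_toReal he, ← EReal.coe_sub]
    exact EReal.coe_le_coe_iff.2 (h he)

end LifelongBandit

/-! ### Combination of the bounds -/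

open LifelongBandit
theorem theorem2 {A : Type*} [Fintype A] [MeasurableSpace A] [DiscreteMeasurableSpace A]
    {n m : ℕ} (hn : 1 ≤ n) (hm : 1 ≤ m)
    (env : Distr (BanditTask A))
    (b : Policies A m) (hb : ∀ i j, IsMarkovKernel (b i j))
    (alg : BaseAlg A) (halg : ∀ k, Measurable (alg k))
    (hmono : MonotoneReward env b alg)
    (P₀ : Distr (Distr A))
    (lam₁ : ℝ≥0) (hlam₁ : 0 < lam₁) (lam₂ : ℝ≥0)
    (δ : ℝ) (hδ : δ ∈ Set.Ioc (0 : ℝ) 1) :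
    ∃ E : Set (Fin n → BanditTask A × Data A m), MeasurableSet E ∧
      1 - ENNReal.ofReal δ ≤ jointLaw env b n E ∧
      ∀ ω ∈ E, (lam₂ : ℝ≥0∞) ≤ m * bMin b ω →
        ∀ 𝒬 : Distr (Distr A),
          ((empiricalReward b alg ω 𝒬 - cTerm env b alg ω : ℝ) : EReal) -
            (((1 / lam₁ + 1 / (n * lam₂)) * klDiv 𝒬.1 P₀.1
              + 1 / (n * m * lam₂) * expectedKL alg ω 𝒬
              + lam₁ / (8 * n)
              + lam₂ * ENNReal.ofReal (Real.exp 1 - 2) / (bMin b ω * m)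
              + 1 / lam₁ * ENNReal.ofReal (Real.log (2 / δ))
              + 1 / (n * lam₂) * ENNReal.ofReal (Real.log (2 * m / δ)) : ℝ≥0∞) : EReal)
          ≤ (transferReward env b alg n 𝒬 : EReal) := by
  obtain ⟨hδ0, hδ1⟩ := hδ
  have hn0 : (0 : ℝ) < n := by exact_mod_cast hn
  have hm0 : (0 : ℝ) < m := by exact_mod_cast hm
  have hm1 : (1 : ℝ) ≤ m := by exact_mod_cast hm
  have hlog2 : 0 < Real.log (2 / δ) := Real.log_pos (by rw [lt_div_iff₀ hδ0]; linarith)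
  have hlogle : Real.log (2 / δ) ≤ Real.log (2 * m / δ) :=
    Real.log_le_log (by positivity) (by gcongr; linarith)
  rcases eq_zero_or_pos lam₂ with rfl | hlam₂
  · refine ⟨Set.univ, MeasurableSet.univ, by simp, fun ω _ _ 𝒬 =>
      ereal_sub_le_of_sub_toReal_le fun h => (h ?_).elim⟩
    -- For `λ₂ = 0` the last penalty is `∞` times a positive number, since `δ ≤ 1` makes the
    -- logarithm positive.
    have hpos : ENNReal.ofReal (Real.log (2 * m / δ)) ≠ 0 :=
      (ENNReal.ofReal_pos.2 (hlog2.trans_le hlogle)).ne'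
    simp [ENNReal.top_mul hpos]
  obtain ⟨hmeas1, hint1⟩ := lintegral_mixture_le_one env b P₀
    (measurable_rewardMoment env b halg (lam₁ / n))
    (lintegral_rewardMoment_le_one env b halg (lam₁ / n)) n
  obtain ⟨hmeas2, hint2⟩ := lintegral_mixture_le_one env b P₀
    (h := fun i P past z => ENNReal.ofReal (deviationMoment b lam₂ i past z P))
    (fun i => (measurable_deviationMoment b lam₂ i).ennreal_ofReal)
    (fun i P past => lintegral_deviationMoment_le_one b env hlam₂ hm i past P) n
  have hE1 := measurableSet_le hmeas1 (measurable_const (a := ENNReal.ofReal (2 / δ)))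
  have hE2 := measurableSet_le hmeas2 (measurable_const (a := ENNReal.ofReal (2 / δ)))
  refine ⟨_, hE1.inter hE2, ?_, ?_⟩
  · rw [← compl_compl (_ ∩ _), prob_compl_eq_one_sub (hE1.inter hE2).compl, Set.compl_inter]
    refine tsub_le_tsub_left ((measure_union_le _ _).trans ((add_le_add
      (measure_lt_le_of_lintegral_le_one hmeas1 hint1 hδ0)
      (measure_lt_le_of_lintegral_le_one hmeas2 hint2 hδ0)).trans (le_of_eq ?_))) 1
    rw [← ENNReal.ofReal_add (by positivity) (by positivity), add_halves]
  rintro ω ⟨hω1, hω2⟩ hle 𝒬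
  refine ereal_sub_le_of_sub_toReal_le fun htop => ?_
  have hc : (0 : ℝ) < 2 / δ := by positivity
  simp only [ENNReal.add_ne_top] at htop
  obtain ⟨⟨⟨⟨⟨h1, h2⟩, h3⟩, h4⟩, h5⟩, h6⟩ := htop
  -- A finite total penalty forces both divergences to be finite, as their coefficients are nonzero.
  have hkl : klDiv 𝒬.1 P₀.1 ≠ ∞ := fun h => h1 (by
    rw [h, ENNReal.mul_top]
    simp)
  have hK : expectedKL alg ω 𝒬 ≠ ∞ := fun h => h2 (by
    rw [h, ENNReal.mul_top]
    simpa using ENNReal.mul_ne_top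
      (ENNReal.mul_ne_top (ENNReal.natCast_ne_top n) (ENNReal.natCast_ne_top m))
      ENNReal.coe_ne_top)
  have hb1 := integral_meanReward_sub_le env b halg hn P₀ 𝒬 (NNReal.coe_pos.2 hlam₁) hc ω hω1 hkl
  have hb2 := integral_meanIwReward_sub_le b halg hn hm P₀ 𝒬 hlam₂ hc ω hω2 hle hkl hK
  have hb3 := integral_meanCondReward_sub_cTerm_le env b halg hmono hn 𝒬 ω
  have hinv1 : 1 / (lam₁ : ℝ≥0∞) ≠ ∞ := by simp [hlam₁.ne']
  have hinv2 : 1 / ((n : ℝ≥0∞) * lam₂) ≠ ∞ := by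
    simp [hlam₂.ne', Nat.one_le_iff_ne_zero.1 hn]
  have h12 := ENNReal.add_ne_top.2 ⟨h1, h2⟩
  have h123 := ENNReal.add_ne_top.2 ⟨h12, h3⟩
  have h1234 := ENNReal.add_ne_top.2 ⟨h123, h4⟩
  rw [ENNReal.toReal_add (ENNReal.add_ne_top.2 ⟨h1234, h5⟩) h6, ENNReal.toReal_add h1234 h5,
    ENNReal.toReal_add h123 h4, ENNReal.toReal_add h12 h3,
    ENNReal.toReal_add h1 h2, ENNReal.toReal_mul, ENNReal.toReal_add hinv1 hinv2, add_mul]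
  simp only [ENNReal.toReal_mul, ENNReal.toReal_div, ENNReal.toReal_one, ENNReal.coe_toReal,
    ENNReal.toReal_natCast, ENNReal.toReal_ofNat, ENNReal.toReal_ofReal exp_one_sub_two_nonneg,
    ENNReal.toReal_ofReal hlog2.le, ENNReal.toReal_ofReal (hlog2.le.trans hlogle)]
  -- The argument gives `log (2 / δ)` here; the claimed `log (2 * m / δ)` is weaker.
  have hl : 1 / (n * lam₂ : ℝ) * Real.log (2 / δ) ≤ 1 / (n * lam₂) * Real.log (2 * m / δ) :=
    mul_le_mul_of_nonneg_left hlogle (by positivity)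
  linarith
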